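/- **Setting.** Let $\dot x=f(x,u)$, $x\in\mathbb R^n$, $u\in\mathbb R^m$, and let $k$ be a smooth feedback, $V$ a smooth function, $\alpha_1,\alpha_2,\gamma_2$ class $\mathcal K_\infty$ functions and $\lambda>0$ with $$\alpha_1(\|x\|)\le V(x)\le\alpha_2(\|x\|),\qquad \nabla V(x)\,f(x,k(x+e))\le-\lambda V(x)+\gamma_2(\|e\|)\qquad\text{for all }x,e .$$ Let $(x,e)\mapsto f(x,k(x+e))$ be locally Lipschitz, let $c\in(0,1)$, let $e\mapsto\psi(e):=\alpha_1^{-1}\big(\tfrac{1}{\lambda(1-c)}\gamma_2(4\|e\|)\big)$ be locally Lipschitz, and let $\mu>0$ satisfy $\gamma_2(4r)\le\mu\,\alpha_1(r)$ for all $r\ge0$ (Assumption 2). Communication is denied on the intervals $H_j=[h_j,h_j+\tau_j)$, $j\in\mathbb N$, where $h_j\ge0$, $\tau_j>0$, $h_j\to\infty$, $\tau_*:=\inf_j\tau_j>0$, and $\big|[0,t]\cap\bigcup_jH_j\big|\le\kappa+t/\tau$ for all $t\ge0$, with $\kappa\ge0$, $\tau>0$ (Assumption 1). Transmissions are attempted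 at times $0=t_0\le t_1\le\cdots$ (possibly only finitely many), and $u(t)=k(x(t_i))$ for the last successful attempt $t_i\le t$, i.e. the last one outside $\bigcup_jH_j$; before the first success the sample $0$ is used. With $e$ the sampled state minus the current state, a successful attempt at $t_i$ is followed by the attempt at $$t_{i+1}=\inf\{s>t_i:\ \gamma_2(4\|e(s)\|)>\lambda(1-c)V(x(s))\},$$ computed along the flow that keeps the sample $x(t_i)$ ($t_{i+1}=\infty$ if there is no such $s$). A denied attempt at $t_i$ is repeated at some later time $t_{i+1}$. Fix $\Delta_*\ge0$. Solutions are considered on an interval $[0,T)$, $0\le T\le\infty$, every instant of which lies in some $[t_i,t_{i+1})$, and such that $\sup_j\sup\{t_{i+1}-t_i:\ t_i\in H_j,\ t_i<T\}\le\Delta_*$. Put $$\gamma=e^{\kappa(\lambda+2\mu)(1+\Delta_*/\tau_*)},\qquad \beta=c\lambda-\frac{\lambda+2\mu}{\tau}\Big(1+\frac{\Delta_*}{\tau_*}\Big).$$ **Theorem.** 1. For every $R>0$, every solution with $\|x(0)\|\le R$ satisfies, at all times $t\in[0,T)$, $$\|x(t)\|\le\alpha_1^{-1}\big(\gamma e^{-\beta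 t}\alpha_2(\|x(0)\|)\big).$$ 2. Suppose that $\displaystyle\tau>\frac{\lambda+2\mu}{c\lambda}\Big(1+\frac{\Delta_*}{\tau_*}\Big)$. Then: - $\beta>0$, the function $(r,t)\mapsto\alpha_1^{-1}(\gamma e^{-\beta t}\alpha_2(r))$ is of class $\mathcal{KL}$, and the origin is semi-globally asymptotically stable: there is a class $\mathcal{KL}$ function $b$ such that, for every $R>0$, every solution with $\|x(0)\|\le R$ satisfies $\|x(t)\|\le b(\|x(0)\|,t)$ for $t\in[0,T)$. - If denied attempts are repeated after at least $\delta$ and at most $\Delta_*$ units of time, $0<\delta\le\Delta_*$, then every solution that cannot be continued (as a solution of this kind) has $T=\infty$. - The update rule has a semi-global uniform finite sampling rate: for every $\delta>0$ and $R>0$ there is $\varepsilon>0$ such that $t_{i+1}-t_i\ge\varepsilon$ for all $i$ with $t_i<T$, for every solution with $\|x(0)\|\le R$ whose denied attempts are followed by at least $\delta$ units of time without an attempt. - For every $R>0$ put $\rho=\alpha_1^{-1}(\gamma\alpha_2(R))$, $\mathcal X=\{\|x\|\le\rho\}$, $\mathcal E=\{\|e\|\le2\rho\}$. There are a Lipschitz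 constant $L>0$ of $f(x,k(x+e))$ on $\mathcal X\times\mathcal E$ (with respect to $\|x\|+\|e\|$) and a $\sigma>0$ such that $1/\sigma$ is a Lipschitz constant of $\psi$ on $\mathcal E$; any such constants satisfy $$\|f(x,k(x+e))\|\le L(\|x\|+\|e\|)\ \text{ on }\mathcal X\times\mathcal E,\qquad \psi(e)\le\tfrac1\sigma\|e\|\ \text{ on }\mathcal E .$$ For all $L,\sigma>0$ satisfying these two inequalities, the number $$\varepsilon_R=\frac1{2L}\ln\Big(\frac{3\sigma+1}{\sigma+1}\Big)$$ is positive, and every solution with $\|x(0)\|\le R$ satisfies $t_{i+1}-t_i\ge\varepsilon_R$ for every successful attempt $t_i<T$, and for every attempt $t_i<T$ if denied attempts are followed by at least $\varepsilon_R$ units of time without an attempt. -/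

import Mathlib

open Set Filter Topology MeasureTheory
open scoped ContDiff

noncomputable section

namespace EventDoS

/-! ## Comparison functions -/

/-- Class `K`: continuous and strictly increasing on `[0, ∞)`, zero at zero. -/
def IsClassK (a : ℝ → ℝ) : Prop :=
  ContinuousOn a (Ici 0) ∧ StrictMonoOn a (Ici 0) ∧ a 0 = 0

/-- Class `K∞`: class `K` and unbounded. -/
def IsClassKInf (a : ℝ → ℝ) : Prop :=
  IsClassK a ∧ Tendsto a atTop atTop

/-- Class `KL`. -/
def IsClassKL (b : ℝ → ℝ → ℝ) : Prop :=
  (∀ s, 0 ≤ s → IsClassK fun r => b r s) ∧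
  ∀ r, 0 ≤ r → AntitoneOn (b r) (Ici 0) ∧ Tendsto (b r) atTop (𝓝 0)

/-- The inverse on `[0, ∞)` of a class `K∞` function. -/
def kInv (a : ℝ → ℝ) (y : ℝ) : ℝ := Function.invFunOn a (Ici 0) y

/-! ## The plant -/

/-- The Euclidean space `ℝⁿ`. -/
abbrev Euc (n : ℕ) := EuclideanSpace ℝ (Fin n)

/-- The bare data of the problem: the system `ẋ = f (x, u)`, the feedback `u = k x`, the
Lyapunov function `V`, the comparison functions and the decay rate `lam`. -/
structure Plant (n m : ℕ) where
  f : Euc n → Euc m → Euc n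
  k : Euc n → Euc m
  V : Euc n → ℝ
  alpha1 : ℝ → ℝ
  alpha2 : ℝ → ℝ
  gamma2 : ℝ → ℝ
  lam : ℝ

variable {n m : ℕ}

/-- The closed-loop vector field `f (x, k (x + e))`. -/
def Plant.F (P : Plant n m) (x e : Euc n) : Euc n := P.f x (P.k (x + e))

/-- The smooth feedback renders the system ISS with respect to measurement errors, with smooth
ISS-Lyapunov function `V`. -/
structure Plant.IsISS (P : Plant n m) : Prop where
  smooth_k : ContDiff ℝ ∞ P.k
  smooth_V : ContDiff ℝ ∞ P.V
  alpha1_kInf : IsClassKInf P.alpha1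
  alpha2_kInf : IsClassKInf P.alpha2
  gamma2_kInf : IsClassKInf P.gamma2
  lam_pos : 0 < P.lam
  lower : ∀ x, P.alpha1 ‖x‖ ≤ P.V x
  upper : ∀ x, P.V x ≤ P.alpha2 ‖x‖
  dissipation : ∀ x e, fderiv ℝ P.V x (P.F x e) ≤ -P.lam * P.V x + P.gamma2 ‖e‖

/-- The triggering condition `γ₂ (4 ‖e‖) ≤ lam (1 - c) V x`. -/
def Plant.Cur (P : Plant n m) (c : ℝ) (x e : Euc n) : Prop :=
  P.gamma2 (4 * ‖e‖) ≤ P.lam * (1 - c) * P.V x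

/-- The function `α₁⁻¹ (γ₂ (4 ‖e‖) / (lam (1 - c)))`. -/
def Plant.psi (P : Plant n m) (c : ℝ) (e : Euc n) : ℝ :=
  kInv P.alpha1 (1 / (P.lam * (1 - c)) * P.gamma2 (4 * ‖e‖))

/-! ## Denial of service -/

/-- A DoS sequence: the `n`-th attack starts at `h n` and lasts `dur n > 0`. -/
structure DoS where
  h : ℕ → ℝ
  dur : ℕ → ℝ
  h_nonneg : ∀ n, 0 ≤ h n
  dur_pos : ∀ n, 0 < dur n

/-- The `n`-th DoS interval. -/
def DoS.H (D : DoS) (n : ℕ) : Set ℝ := Ico (D.h n) (D.h n + D.dur n)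

/-- All instants at which communication is denied. -/
def DoS.denied (D : DoS) : Set ℝ := ⋃ n, D.H n

/-- The part of `[0, t]` in which communication is possible. -/
def DoS.Theta (D : DoS) (t : ℝ) : Set ℝ := Icc 0 t \ D.denied

/-- The part of `[0, t]` in which communication is denied. -/
def DoS.Xi (D : DoS) (t : ℝ) : Set ℝ := D.denied ∩ Icc 0 t

/-- The infimum of the durations of the attacks. -/
def DoS.tauStar (D : DoS) : ℝ := ⨅ n, D.dur n

/-- Slow DoS: `h n → ∞` and the time under attack up to `t` is at most `kap + t / tau`. -/
def DoS.IsSlow (D : DoS) (kap tau : ℝ) : Prop :=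
  Tendsto D.h atTop atTop ∧ 0 ≤ kap ∧ 0 < tau ∧
  ∀ t, 0 ≤ t → volume.real (D.Xi t) ≤ kap + t / tau

/-! ## The sampled closed loop

A sampling sequence is `t : ℕ → EReal`; the value `⊤` means that no further sampling takes place.
-/

/-- The sample in use at time `s`: `x (t_k)` for the last `k` with `t_k ∈ Θ(s)`, and `0` while no
transmission has been successful. -/
def held (D : DoS) (t : ℕ → EReal) (x : ℝ → Euc n) (s : ℝ) : Euc n :=
  open Classical in
  if {k : ℕ | ∃ r ∈ D.Theta s, t k = (r : EReal)}.Nonempty then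
    x (t (sSup {k : ℕ | ∃ r ∈ D.Theta s, t k = (r : EReal)})).toReal
  else 0

/-- `z` solves `ż = f (z, k v)` on `[a, b]`, the sample `v` being held. -/
def Plant.HeldFlow (P : Plant n m) (v : Euc n) (a b : ℝ) (z : ℝ → Euc n) : Prop :=
  ContinuousOn z (Icc a b) ∧
  ∀ s ∈ Ico a b, HasDerivWithinAt z (P.f (z s) (P.k v)) (Ici s) s

/-- The event-triggered instant after a successful transmission of the state `v` at time `a`: the
infimum of the times `s > a` at which the triggering condition is violated along the flow that
starts at `v` and keeps the sample `v` (it is `⊤` if there is no violation). -/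
def Plant.nextSample (P : Plant n m) (c a : ℝ) (v : Euc n) : EReal :=
  sInf {r : EReal | ∃ s : ℝ, r = (s : EReal) ∧ a < s ∧
    ∃ z : ℝ → Euc n, z a = v ∧ P.HeldFlow v a s z ∧ ¬ P.Cur c (z s) (v - z s)}

/-- `(x, t)` is a solution on `[0, T)`, with initial state `x₀`, of the closed loop under the DoS
sequence `D`, where `x` is the state and `t` the sampling sequence: the held sample is fed back;
after a successful transmission the next one is triggered by the event rule; after a
transmission that is denied a new attempt is made later. -/
structure IsSolution (P : Plant n m) (c : ℝ) (D : DoS) (x₀ : Euc n) (T : EReal)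
    (t : ℕ → EReal) (x : ℝ → Euc n) : Prop where
  T_nonneg : 0 ≤ T
  init : x 0 = x₀
  t_zero : t 0 = 0
  t_mono : Monotone t
  /-- Every instant of `[0, T)` lies in a sampling interval. -/
  cover : ∀ s : ℝ, 0 ≤ s → (s : EReal) < T → ∃ k, t k ≤ (s : EReal) ∧ (s : EReal) < t (k + 1)
  cont : ContinuousOn x {s : ℝ | 0 ≤ s ∧ (s : EReal) < T}
  ode : ∀ s : ℝ, 0 ≤ s → (s : EReal) < T →
    HasDerivWithinAt x (P.f (x s) (P.k (held D t x s))) (Ici s) s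
  /-- The event rule after a success. -/
  trigger : ∀ (k : ℕ) (s : ℝ), t k = (s : EReal) → (s : EReal) < T → s ∉ D.denied →
    t (k + 1) = P.nextSample c s (x s)
  /-- A new attempt after a failure. -/
  retry : ∀ (k : ℕ) (s : ℝ), t k = (s : EReal) → (s : EReal) < T → s ∈ D.denied →
    t k < t (k + 1)

/-- The indices of the attempts made (before time `T`) during the `n`-th attack. -/
def attempts (D : DoS) (T : EReal) (t : ℕ → EReal) (n : ℕ) : Set ℕ :=
  {k : ℕ | t k < T ∧ ∃ s ∈ D.H n, t k = (s : EReal)}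

/-- `Δ_* = sup_n sup_{k ∈ S_n} (t_{k+1} - t_k)`. -/
def deltaStar (D : DoS) (T : EReal) (t : ℕ → EReal) : EReal :=
  ⨆ n : ℕ, ⨆ k ∈ attempts D T t n, (t (k + 1) - t k)

/-- Every denied attempt is followed by at least `del` units of time without an attempt. -/
def RetrySpaced (D : DoS) (T : EReal) (t : ℕ → EReal) (del : ℝ) : Prop :=
  ∀ (k : ℕ) (s : ℝ), t k = (s : EReal) → (s : EReal) < T → s ∈ D.denied →
    t k + (del : EReal) ≤ t (k + 1)

/-- Solutions on `[0, T)` whose denied attempts are repeated after a time between `del` and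
`Del`. -/
def IsPaced (P : Plant n m) (c : ℝ) (D : DoS) (del Del : ℝ) (x₀ : Euc n) (T : EReal)
    (t : ℕ → EReal) (x : ℝ → Euc n) : Prop :=
  IsSolution P c D x₀ T t x ∧ RetrySpaced D T t del ∧ deltaStar D T t ≤ (Del : EReal)

/-- The solution cannot be continued beyond `T`. -/
def IsMaximal (P : Plant n m) (c : ℝ) (D : DoS) (del Del : ℝ) (x₀ : Euc n) (T : EReal)
    (t : ℕ → EReal) (x : ℝ → Euc n) : Prop :=
  IsPaced P c D del Del x₀ T t x ∧
  ¬ ∃ (T' : EReal) (t' : ℕ → EReal) (x' : ℝ → Euc n), T < T' ∧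
      IsPaced P c D del Del x₀ T' t' x' ∧
      (∀ s : ℝ, 0 ≤ s → (s : EReal) < T → x' s = x s) ∧ ∀ k, t k < T → t' k = t k

/-- Semi-global asymptotic stability of the origin. -/
def SemiGlobalAS (P : Plant n m) (c : ℝ) (D : DoS) (Del : ℝ) : Prop :=
  ∃ b : ℝ → ℝ → ℝ, IsClassKL b ∧ ∀ R > 0, ∀ (x₀ : Euc n) (T : EReal) (t : ℕ → EReal)
    (x : ℝ → Euc n), IsSolution P c D x₀ T t x → deltaStar D T t ≤ (Del : EReal) → ‖x₀‖ ≤ R →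
    ∀ s : ℝ, 0 ≤ s → (s : EReal) < T → ‖x s‖ ≤ b ‖x₀‖ s

/-- Semi-global uniform finite sampling rate. -/
def SemiGlobalFSR (P : Plant n m) (c : ℝ) (D : DoS) (del Del : ℝ) : Prop :=
  ∀ R > 0, ∃ eps : ℝ, 0 < eps ∧ ∀ (x₀ : Euc n) (T : EReal) (t : ℕ → EReal) (x : ℝ → Euc n),
    IsPaced P c D del Del x₀ T t x → ‖x₀‖ ≤ R →
    ∀ k, t k < T → t k + (eps : EReal) ≤ t (k + 1)

/-! ## The constants -/

/-- `γ = exp (kap (lam + 2 mu) (1 + Δ_* / τ_*))`. -/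
def gam (kap lam mu Del tauS : ℝ) : ℝ := Real.exp (kap * (lam + 2 * mu) * (1 + Del / tauS))

/-- `β = c lam - (lam + 2 mu) / tau (1 + Δ_* / τ_*)`. -/
def bet (c lam mu tau Del tauS : ℝ) : ℝ := c * lam - (lam + 2 * mu) / tau * (1 + Del / tauS)

/-- The radius `α₁⁻¹ (γ α₂ R)`. -/
def Plant.rad (P : Plant n m) (g R : ℝ) : ℝ := kInv P.alpha1 (g * P.alpha2 R)

/-- `L` is a Lipschitz constant of `f (x, k (x + e))` for `‖x‖ ≤ rho`, `‖e‖ ≤ 2 rho`. -/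
def Plant.FieldLip (P : Plant n m) (rho L : ℝ) : Prop :=
  ∀ x e x' e' : Euc n, ‖x‖ ≤ rho → ‖e‖ ≤ 2 * rho → ‖x'‖ ≤ rho → ‖e'‖ ≤ 2 * rho →
    ‖P.F x e - P.F x' e'‖ ≤ L * (‖x - x'‖ + ‖e - e'‖)

/-- `‖f (x, k (x + e))‖ ≤ L (‖x‖ + ‖e‖)` for `‖x‖ ≤ rho`, `‖e‖ ≤ 2 rho`. -/
def Plant.FieldBound (P : Plant n m) (rho L : ℝ) : Prop :=
  ∀ x e : Euc n, ‖x‖ ≤ rho → ‖e‖ ≤ 2 * rho → ‖P.F x e‖ ≤ L * (‖x‖ + ‖e‖)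

/-- `1 / sig` is a Lipschitz constant of `psi` for `‖e‖ ≤ 2 rho`. -/
def Plant.ErrLip (P : Plant n m) (c rho sig : ℝ) : Prop :=
  ∀ e e' : Euc n, ‖e‖ ≤ 2 * rho → ‖e'‖ ≤ 2 * rho →
    |P.psi c e - P.psi c e'| ≤ 1 / sig * ‖e - e'‖

/-- `psi e ≤ ‖e‖ / sig` for `‖e‖ ≤ 2 rho`. -/
def Plant.ErrBound (P : Plant n m) (c rho sig : ℝ) : Prop :=
  ∀ e : Euc n, ‖e‖ ≤ 2 * rho → P.psi c e ≤ 1 / sig * ‖e‖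

/-- `ε_R = 1 / (2 L) ln ((3 sig + 1) / (sig + 1))`. -/
def epsR (L sig : ℝ) : ℝ := 1 / (2 * L) * Real.log ((3 * sig + 1) / (sig + 1))

end EventDoS

end

namespace EventDoS

/-! ## Comparison functions -/

/-! Set the error `e` to be the held sample minus the state. After a successful transmission the
trigger keeps γ₂(4‖e‖) ≤ λ(1-c)V, so V decays at rate cλ (`Plant.IsISS.decay_of_cur`). After a
denied attempt the sample is out of date, but it was admissible when last checked. Splitting v - y
into three pieces and using `IsClassK.apply_add_add_le` together with γ₂(4r) ≤ μα₁(r) bounds γ₂(‖v -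
y‖) by μV(y) plus a multiple of the current bound on V, so V grows at rate at most 2μ
(`Plant.IsISS.growth`).

Growth is confined to the shadow of the attacks, that is, to instants less than Δ_* after an instant
of denial. Each cluster of overlapping or adjacent attacks adds at most Δ_* to the time under attack
and itself contains at least τ_* of it, so the shadow has measure at most (1 + Δ_*/τ_*) times the
time under attack (`DoS.volume_shadow_le`). An envelope that decays at rate cλ off the shadow and
grows at rate 2μ on it therefore dominates V at every attempt, by induction
(`IsSolution.envelope_invariant`). The slow-DoS bound turns the envelope into γ e^{-βs} V(x₀)
(`IsSolution.V_le`).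

If β > 0, states stay in the ball of radius ρ. There the field and ψ have linear bounds, and a
Gronwall estimate of ‖e‖ against ‖z‖ shows that no violation can occur within `epsR` after a success
(`Plant.IsISS.cur_before_epsR`). Hence attempts do not accumulate, and a bounded solution on a
finite interval has a limit at its right end and can be continued (`IsMaximal.eq_top`). -/

lemma IsClassK.nonneg {a : ℝ → ℝ} (ha : IsClassK a) {r : ℝ} (hr : 0 ≤ r) : 0 ≤ a r := by
  have h := ha.2.1.monotoneOn (mem_Ici.2 le_rfl) (mem_Ici.2 hr) hr
  rwa [ha.2.2] at h

lemma IsClassK.mono {a : ℝ → ℝ} (ha : IsClassK a) {r s : ℝ} (hr : 0 ≤ r) (hrs : r ≤ s) :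
    a r ≤ a s :=
  ha.2.1.monotoneOn (mem_Ici.2 hr) (mem_Ici.2 (hr.trans hrs)) hrs

lemma IsClassK.pos {a : ℝ → ℝ} (ha : IsClassK a) {r : ℝ} (hr : 0 < r) : 0 < a r := by
  have h := ha.2.1 (mem_Ici.2 le_rfl) (mem_Ici.2 hr.le) hr
  rwa [ha.2.2] at h

lemma IsClassK.le_of_apply_le {a : ℝ → ℝ} (ha : IsClassK a) {r s : ℝ} (hr : 0 ≤ r) (hs : 0 ≤ s)
    (h : a r ≤ a s) : r ≤ s :=
  (ha.2.1.le_iff_le (mem_Ici.2 hr) (mem_Ici.2 hs)).1 h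

/-- The sum is at most three times, hence at most four times, the largest term. This is where the
factor 4 in the triggering condition is spent. -/
lemma IsClassK.apply_add_add_le {a : ℝ → ℝ} (ha : IsClassK a) {x y z : ℝ}
    (hx : 0 ≤ x) (hy : 0 ≤ y) (hz : 0 ≤ z) :
    a (x + y + z) ≤ a (4 * x) + a (4 * y) + a (4 * z) := by
  have h1 := ha.nonneg (mul_nonneg (by norm_num : (0 : ℝ) ≤ 4) hx)
  have h2 := ha.nonneg (mul_nonneg (by norm_num : (0 : ℝ) ≤ 4) hy)
  have h3 := ha.nonneg (mul_nonneg (by norm_num : (0 : ℝ) ≤ 4) hz)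
  have h0 : 0 ≤ x + y + z := by positivity
  rcases le_total x y with hxy | hxy
  · rcases le_total y z with hyz | hyz
    · linarith [ha.mono h0 (by linarith : x + y + z ≤ 4 * z)]
    · linarith [ha.mono h0 (by linarith : x + y + z ≤ 4 * y)]
  · rcases le_total x z with hxz | hxz
    · linarith [ha.mono h0 (by linarith : x + y + z ≤ 4 * z)]
    · linarith [ha.mono h0 (by linarith : x + y + z ≤ 4 * x)]

lemma IsClassKInf.surjOn {a : ℝ → ℝ} (ha : IsClassKInf a) : SurjOn a (Ici 0) (Ici 0) := by
  intro y hy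
  obtain ⟨b, hb0, hb⟩ := ((eventually_ge_atTop 0).and (ha.2.eventually_ge_atTop y)).exists
  have h := intermediate_value_Icc hb0 (ha.1.1.mono Icc_subset_Ici_self)
  rw [ha.1.2.2] at h
  obtain ⟨x, hx, rfl⟩ := h ⟨hy, hb⟩
  exact ⟨x, hx.1, rfl⟩

lemma IsClassKInf.kInv_nonneg {a : ℝ → ℝ} (ha : IsClassKInf a) {y : ℝ} (hy : 0 ≤ y) :
    0 ≤ kInv a y :=
  Function.invFunOn_mem (ha.surjOn (mem_Ici.2 hy))

lemma IsClassKInf.apply_kInv {a : ℝ → ℝ} (ha : IsClassKInf a) {y : ℝ} (hy : 0 ≤ y) :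
    a (kInv a y) = y :=
  Function.invFunOn_eq (ha.surjOn (mem_Ici.2 hy))

lemma IsClassKInf.kInv_apply {a : ℝ → ℝ} (ha : IsClassKInf a) {r : ℝ} (hr : 0 ≤ r) :
    kInv a (a r) = r :=
  ha.1.2.1.injOn (ha.kInv_nonneg (ha.1.nonneg hr)) hr (ha.apply_kInv (ha.1.nonneg hr))

lemma IsClassKInf.le_kInv {a : ℝ → ℝ} (ha : IsClassKInf a) {r y : ℝ} (hr : 0 ≤ r)
    (h : a r ≤ y) : r ≤ kInv a y := by
  have hy := (ha.1.nonneg hr).trans h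
  exact ha.1.le_of_apply_le hr (ha.kInv_nonneg hy) (by rwa [ha.apply_kInv hy])

lemma IsClassKInf.kInv_zero {a : ℝ → ℝ} (ha : IsClassKInf a) : kInv a 0 = 0 := by
  have h := ha.kInv_apply (le_refl (0 : ℝ))
  rwa [ha.1.2.2] at h

lemma IsClassKInf.kInv_strictMonoOn {a : ℝ → ℝ} (ha : IsClassKInf a) :
    StrictMonoOn (kInv a) (Ici 0) := by
  intro y hy z hz hyz
  rw [← ha.1.2.1.lt_iff_lt (ha.kInv_nonneg hy) (ha.kInv_nonneg hz), ha.apply_kInv hy,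
    ha.apply_kInv hz]
  exact hyz

lemma IsClassKInf.kInv_continuousOn {a : ℝ → ℝ} (ha : IsClassKInf a) :
    ContinuousOn (kInv a) (Ici 0) := by
  -- Extended by the identity to negative arguments, the inverse is monotone and onto ℝ, hence
  -- continuous.
  have hmono : Monotone fun y => if y < 0 then y else kInv a y := by
    intro y z hyz
    dsimp only
    split_ifs with h1 h2 h2
    · exact hyz
    · exact h1.le.trans (ha.kInv_nonneg (not_lt.1 h2))
    · exact absurd (hyz.trans_lt h2) h1
    · exact ha.kInv_strictMonoOn.monotoneOn (not_lt.1 h1) (not_lt.1 h2) hyz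
  have hsurj : Function.Surjective fun y => if y < 0 then y else kInv a y := by
    intro r
    rcases lt_or_ge r 0 with hr | hr
    · exact ⟨r, if_pos hr⟩
    · exact ⟨a r, by
        dsimp only
        rw [if_neg (not_lt.2 (ha.1.nonneg hr)), ha.kInv_apply hr]⟩
  refine (hmono.continuous_of_surjective hsurj).continuousOn.congr fun y hy => ?_
  exact (if_neg (not_lt.2 hy)).symm

lemma IsClassKInf.kInv_comp_mul {a b : ℝ → ℝ} (ha : IsClassKInf a) (hb : IsClassKInf b) {C : ℝ}
    (hC : 0 < C) : IsClassK fun r => kInv a (C * b r) := by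
  have hmaps : MapsTo (fun r => C * b r) (Ici 0) (Ici 0) := fun r hr =>
    mul_nonneg hC.le (hb.1.nonneg hr)
  refine ⟨ha.kInv_continuousOn.comp (continuousOn_const.mul hb.1.1) hmaps, ?_, ?_⟩
  · intro r hr s hs hrs
    exact ha.kInv_strictMonoOn (hmaps hr) (hmaps hs) (mul_lt_mul_of_pos_left (hb.1.2.1 hr hs hrs) hC)
  · simp only [hb.1.2.2, mul_zero, ha.kInv_zero]

lemma IsClassKInf.isClassKL_exp {a b : ℝ → ℝ} (ha : IsClassKInf a) (hb : IsClassKInf b)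
    {g β : ℝ} (hg : 0 < g) (hβ : 0 < β) :
    IsClassKL fun r s => kInv a (g * Real.exp (-β * s) * b r) := by
  refine ⟨fun s _ => ha.kInv_comp_mul hb (by positivity), fun r hr => ⟨?_, ?_⟩⟩
  · have hbr := hb.1.nonneg hr
    intro s _ s' _ hss
    refine ha.kInv_strictMonoOn.monotoneOn (mem_Ici.2 (by positivity)) (mem_Ici.2 (by positivity)) ?_
    have : Real.exp (-β * s') ≤ Real.exp (-β * s) := Real.exp_le_exp.2 (by nlinarith)
    gcongr
  · have hbr := hb.1.nonneg hr
    have h1 : Tendsto (fun s => g * Real.exp (-β * s) * b r) atTop (𝓝 0) := by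
      have h2 : Tendsto (fun s : ℝ => Real.exp (-β * s)) atTop (𝓝 0) :=
        Real.tendsto_exp_atBot.comp (tendsto_id.const_mul_atTop_of_neg (neg_lt_zero.2 hβ))
      simpa using (h2.const_mul g).mul_const (b r)
    have h3 : Tendsto (kInv a) (𝓝[Ici 0] 0) (𝓝 0) := by
      have := ha.kInv_continuousOn 0 (mem_Ici.2 le_rfl)
      rwa [ContinuousWithinAt, ha.kInv_zero] at this
    exact h3.comp (tendsto_nhdsWithin_iff.2 ⟨h1, Eventually.of_forall fun s =>
      mem_Ici.2 (by positivity)⟩)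

/-! ## Flows along which the sample is held -/

variable {n m : ℕ} {P : Plant n m}

lemma Plant.f_eq_F (P : Plant n m) (z v : Euc n) : P.f z (P.k v) = P.F z (v - z) := by
  rw [Plant.F, add_sub_cancel]

lemma Plant.IsISS.V_nonneg (h : P.IsISS) (x : Euc n) : 0 ≤ P.V x :=
  (h.alpha1_kInf.1.nonneg (norm_nonneg x)).trans (h.lower x)

lemma Plant.IsISS.eq_zero_of_V_le (h : P.IsISS) {x : Euc n} (hx : P.V x ≤ 0) : x = 0 := by
  by_contra hne
  linarith [h.lower x, h.alpha1_kInf.1.pos (norm_pos_iff.2 hne)]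

lemma Plant.IsISS.V_zero (h : P.IsISS) : P.V 0 = 0 := by
  refine le_antisymm ?_ (h.V_nonneg 0)
  simpa [h.alpha2_kInf.1.2.2] using h.upper 0

lemma Plant.IsISS.V_continuous (h : P.IsISS) : Continuous P.V := h.smooth_V.continuous

lemma Plant.IsISS.V_hasDeriv (h : P.IsISS) {z : ℝ → Euc n} {z' : Euc n} {s : ℝ} {S : Set ℝ}
    (hz : HasDerivWithinAt z z' S s) :
    HasDerivWithinAt (fun r => P.V (z r)) (fderiv ℝ P.V (z s) z') S s :=
  ((h.smooth_V.differentiable (by simp)) (z s)).hasFDerivAt.comp_hasDerivWithinAt s hz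

/-- An exponential bound from a linear differential inequality. -/
lemma le_mul_exp_of_deriv_right_le {g g' : ℝ → ℝ} {K a b : ℝ} (hab : a ≤ b)
    (hg : ContinuousOn g (Icc a b)) (hg' : ∀ s ∈ Ico a b, HasDerivWithinAt g (g' s) (Ici s) s)
    (bound : ∀ s ∈ Ico a b, g' s ≤ K * g s) : g b ≤ g a * Real.exp (K * (b - a)) := by
  have h := le_gronwallBound_of_liminf_deriv_right_le (ε := 0) hg
    (fun s hs r hr => (hg' s hs).liminf_right_slope_le hr) le_rfl
    (fun s hs => by simpa using bound s hs) b (right_mem_Icc.2 hab)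
  rwa [gronwallBound_ε0] at h

lemma Plant.HeldFlow.mono {v : Euc n} {a b a' b' : ℝ} {z : ℝ → Euc n} (hz : P.HeldFlow v a b z)
    (ha : a ≤ a') (hb : b' ≤ b) : P.HeldFlow v a' b' z :=
  ⟨hz.1.mono (Icc_subset_Icc ha hb), fun s hs => hz.2 s ⟨ha.trans hs.1, hs.2.trans_le hb⟩⟩

lemma Plant.IsISS.decay_of_cur (h : P.IsISS) {c : ℝ} {v : Euc n} {a b : ℝ} {z : ℝ → Euc n}
    (hz : P.HeldFlow v a b z) (hab : a ≤ b) (hcur : ∀ s ∈ Ico a b, P.Cur c (z s) (v - z s)) :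
    P.V (z b) ≤ P.V (z a) * Real.exp (-(c * P.lam) * (b - a)) := by
  refine le_mul_exp_of_deriv_right_le hab (h.V_continuous.comp_continuousOn hz.1)
    (fun s hs => h.V_hasDeriv (hz.2 s hs)) fun s hs => ?_
  rw [P.f_eq_F]
  change _ ≤ -(c * P.lam) * P.V (z s)
  have h1 := h.dissipation (z s) (v - z s)
  have h2 := hcur s hs
  -- The dissipation inequality contains γ₂(‖e‖), the trigger controls the larger γ₂(4‖e‖).
  have h3 := h.gamma2_kInf.1.mono (norm_nonneg (v - z s))
    (by linarith [norm_nonneg (v - z s)] : ‖v - z s‖ ≤ 4 * ‖v - z s‖)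
  unfold Plant.Cur at h2
  linarith

/-- V is compared with M·E, where E = exp(2μ(s - a)) ≥ 1. Where the two touch, the derivative of V
is at most -λME + μME + μM + λ(1-c)M ≤ 2μME - cλM. The last term makes the inequality strict, which
is why M must be positive. -/
lemma Plant.IsISS.growth (h : P.IsISS) {c mu M : ℝ} (hc0 : 0 < c) (hmu : 0 < mu) (hM : 0 < M)
    {v : Euc n} {a b : ℝ} {z : ℝ → Euc n} (hz : P.HeldFlow v a b z) (hab : a ≤ b)
    (hv : ∀ y, P.gamma2 ‖v - y‖ ≤ mu * P.V y + (mu + P.lam * (1 - c)) * M)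
    (ha : P.V (z a) ≤ M) : P.V (z b) ≤ M * Real.exp (2 * mu * (b - a)) := by
  have hB : ∀ s, HasDerivAt (fun s => M * Real.exp (2 * mu * (s - a)))
      (M * (Real.exp (2 * mu * (s - a)) * (2 * mu * 1))) s := fun s =>
    ((((hasDerivAt_id s).sub_const a).const_mul (2 * mu)).exp).const_mul M
  refine image_le_of_deriv_right_lt_deriv_boundary' (h.V_continuous.comp_continuousOn hz.1)
    (fun s hs => h.V_hasDeriv (hz.2 s hs)) (by simpa using ha)
    (fun s _ => (hB s).continuousAt.continuousWithinAt) (fun s _ => (hB s).hasDerivWithinAt)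
    (fun s hs heq => ?_) (right_mem_Icc.2 hab)
  rw [P.f_eq_F]
  have h1 := h.dissipation (z s) (v - z s)
  have h2 := hv (z s)
  have h3 : 1 ≤ Real.exp (2 * mu * (s - a)) :=
    Real.one_le_exp (mul_nonneg (by positivity) (sub_nonneg.2 hs.1))
  have h4 := h.lam_pos
  change P.V (z s) = _ at heq
  rw [heq] at h1 h2
  set E := Real.exp (2 * mu * (s - a))
  have h5 : mu * M ≤ mu * (M * E) := by
    have : M * 1 ≤ M * E := by gcongr
    gcongr; linarith
  have h6 : P.lam * M ≤ P.lam * (M * E) := by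
    have : M * 1 ≤ M * E := by gcongr
    gcongr; linarith
  have h7 : 0 < P.lam * c * M := by positivity
  linarith

lemma locallyLipschitz_comp_sub {E : Type*} [NormedAddCommGroup E] {G : E × E → E}
    (hG : LocallyLipschitz G) (v : E) : LocallyLipschitz fun z => G (z, v - z) := by
  have h : LipschitzWith (max 1 (0 + 1)) fun z : E => (z, v - z) :=
    LipschitzWith.id.prodMk ((LipschitzWith.const v).sub LipschitzWith.id)
  exact hG.comp h.locallyLipschitz

lemma locallyLipschitz_comp_mk {E : Type*} [NormedAddCommGroup E] {G : E × E → E}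
    (hG : LocallyLipschitz G) (e : E) : LocallyLipschitz fun z => G (z, e) := by
  have h : LipschitzWith (max 1 0) fun z : E => (z, e) :=
    LipschitzWith.id.prodMk (LipschitzWith.const e)
  exact hG.comp h.locallyLipschitz

lemma locallyLipschitz_held (hF : LocallyLipschitz fun p : Euc n × Euc n => P.F p.1 p.2)
    (v : Euc n) : LocallyLipschitz fun z => P.F z (v - z) :=
  locallyLipschitz_comp_sub hF v

/-- Local solvability of an autonomous equation with a locally Lipschitz right-hand side. -/
lemma exists_forward_solution {E : Type*} [NormedAddCommGroup E] [NormedSpace ℝ E]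
    [CompleteSpace E] [ProperSpace E] {g : E → E} (hg : LocallyLipschitz g)
    (y : E) (a : ℝ) : ∃ δ > 0, ∃ z : ℝ → E, z a = y ∧ ContinuousOn z (Icc a (a + δ)) ∧
      ∀ s ∈ Ico a (a + δ), HasDerivWithinAt z (g (z s)) (Ici s) s := by
  obtain ⟨K, U, hU, hK⟩ := hg y
  obtain ⟨ρ, hρ, hball⟩ := Metric.nhds_basis_closedBall.mem_iff.1 hU
  obtain ⟨C, hC⟩ := (isCompact_closedBall y ρ).exists_bound_of_continuousOn hg.continuous.continuousOn
  set B : ℝ := max C 1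
  have hB : 0 < B := lt_max_of_lt_right one_pos
  set δ : ℝ := ρ / B
  have hδ : 0 < δ := div_pos hρ hB
  let t₀ : Icc (a - δ) (a + δ) := ⟨a, by constructor <;> linarith⟩
  -- The time ρ/B is too short to leave the ball of radius ρ at speed at most B.
  have hpl : IsPicardLindelof (fun _ => g) t₀ y ⟨ρ, hρ.le⟩ 0 ⟨B, hB.le⟩ K := by
    refine IsPicardLindelof.of_time_independent (fun x hx => (hC x hx).trans (le_max_left _ _))
      (hK.mono hball) ?_
    have h1 : a + δ - a = δ := by ring
    have h2 : a - (a - δ) = δ := by ring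
    change B * max (a + δ - a) (a - (a - δ)) ≤ ρ - ((0 : NNReal) : ℝ)
    rw [h1, h2, max_self, mul_div_cancel₀ _ hB.ne']
    simp
  obtain ⟨z, hz0, hz⟩ := hpl.exists_eq_forall_mem_Icc_hasDerivWithinAt₀
  refine ⟨δ, hδ, z, hz0, fun s hs => ?_, fun s hs => ?_⟩
  · exact ((hz s ⟨by linarith [hs.1], hs.2⟩).continuousWithinAt).mono
      (Icc_subset_Icc_left (by linarith))
  · have h1 : Icc (a - δ) (a + δ) ∈ 𝓝 s := Icc_mem_nhds (by linarith [hs.1]) hs.2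
    exact ((hz s ⟨by linarith [hs.1], hs.2.le⟩).hasDerivAt h1).hasDerivWithinAt

lemma exists_heldFlow (hF : LocallyLipschitz fun p : Euc n × Euc n => P.F p.1 p.2)
    (v y : Euc n) (a : ℝ) : ∃ δ > 0, ∃ z : ℝ → Euc n, z a = y ∧ P.HeldFlow v a (a + δ) z := by
  obtain ⟨δ, hδ, z, hz, hc, hd⟩ := exists_forward_solution (locallyLipschitz_held hF v) y a
  exact ⟨δ, hδ, z, hz, hc, fun s hs => by rw [P.f_eq_F]; exact hd s hs⟩

/-- The origin is an equilibrium of the closed loop. -/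
lemma Plant.IsISS.F_zero (h : P.IsISS)
    (hF : LocallyLipschitz fun p : Euc n × Euc n => P.F p.1 p.2) : P.F 0 0 = 0 := by
  have hg : LocallyLipschitz fun z => P.F z 0 := locallyLipschitz_comp_mk hF 0
  obtain ⟨δ, hδ, z, hz, hc, hd⟩ := exists_forward_solution hg 0 0
  rw [zero_add] at hc hd
  -- With zero error V' ≤ -λV, so a solution issuing from the origin stays there, and its derivative
  -- at the initial time is both 0 and `P.F 0 0`.
  have hzero : ∀ s ∈ Icc 0 δ, z s = 0 := by
    intro s hs
    refine h.eq_zero_of_V_le ?_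
    have h1 := le_mul_exp_of_deriv_right_le (K := -P.lam) hs.1
      (h.V_continuous.comp_continuousOn (hc.mono (Icc_subset_Icc_right hs.2)))
      (fun r hr => h.V_hasDeriv (hd r ⟨hr.1, hr.2.trans_le hs.2⟩)) fun r _ => by
        have := h.dissipation (z r) 0
        rwa [norm_zero, h.gamma2_kInf.1.2.2, add_zero] at this
    simpa [hz, h.V_zero] using h1
  have h1 := hd 0 ⟨le_rfl, hδ⟩
  rw [hz] at h1
  have h2 : HasDerivWithinAt z 0 (Ici 0) 0 :=
    (hasDerivWithinAt_const (0 : ℝ) (Ici 0) (0 : Euc n)).congr_of_eventuallyEq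
      (by filter_upwards [Icc_mem_nhdsGE hδ] with s hs using hzero s hs) hz
  exact (uniqueDiffWithinAt_Ici 0).eq_deriv _ h1 h2

/-! ## Lipschitz constants on balls -/

lemma Plant.exists_fieldLip (hF : LocallyLipschitz fun p : Euc n × Euc n => P.F p.1 p.2) (ρ : ℝ) :
    ∃ L > 0, P.FieldLip ρ L := by
  obtain ⟨K, hK⟩ := (hF.locallyLipschitzOn
    (s := Metric.closedBall (0 : Euc n) ρ ×ˢ Metric.closedBall (0 : Euc n) (2 * ρ))
    ).exists_lipschitzOnWith_of_compact
      ((isCompact_closedBall _ _).prod (isCompact_closedBall _ _))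
  refine ⟨K + 1, by positivity, fun x e x' e' hx he hx' he' => ?_⟩
  have h := hK.dist_le_mul (x, e) ⟨by simpa using hx, by simpa using he⟩ (x', e')
    ⟨by simpa using hx', by simpa using he'⟩
  rw [dist_eq_norm, Prod.dist_eq, dist_eq_norm, dist_eq_norm] at h
  refine h.trans ?_
  have h1 : max ‖x - x'‖ ‖e - e'‖ ≤ ‖x - x'‖ + ‖e - e'‖ :=
    max_le_add_of_nonneg (norm_nonneg _) (norm_nonneg _)
  gcongr
  linarith

lemma Plant.exists_errLip {c : ℝ} (hpsi : LocallyLipschitz (P.psi c)) (ρ : ℝ) :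
    ∃ sig > 0, P.ErrLip c ρ sig := by
  obtain ⟨K, hK⟩ := (hpsi.locallyLipschitzOn
    (s := Metric.closedBall (0 : Euc n) (2 * ρ))).exists_lipschitzOnWith_of_compact
      (isCompact_closedBall _ _)
  refine ⟨1 / (K + 1), by positivity, fun e e' he he' => ?_⟩
  have h := hK.dist_le_mul e (by simpa using he) e' (by simpa using he')
  rw [Real.dist_eq, dist_eq_norm] at h
  refine h.trans ?_
  rw [one_div_one_div]
  gcongr
  linarith

lemma Plant.FieldLip.fieldBound {ρ L : ℝ} (h : P.FieldLip ρ L) (hρ : 0 ≤ ρ)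
    (h0 : P.F 0 0 = 0) : P.FieldBound ρ L := fun x e hx he => by
  simpa [h0] using h x e 0 0 hx he (by simpa using hρ) (by simpa using hρ)

lemma Plant.IsISS.psi_zero (h : P.IsISS) (c : ℝ) : P.psi c 0 = 0 := by
  simp [Plant.psi, h.gamma2_kInf.1.2.2, h.alpha1_kInf.kInv_zero]

lemma Plant.ErrLip.errBound {c ρ sig : ℝ} (h : P.ErrLip c ρ sig) (hISS : P.IsISS) (hρ : 0 ≤ ρ) :
    P.ErrBound c ρ sig := fun e he => by
  have h1 := h e 0 he (by simpa using hρ)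
  rw [hISS.psi_zero, sub_zero, sub_zero] at h1
  exact (le_abs_self _).trans h1

/-! ## The minimal inter-sampling time -/

lemma epsR_pos {L sig : ℝ} (hL : 0 < L) (hsig : 0 < sig) : 0 < epsR L sig :=
  mul_pos (by positivity) (Real.log_pos ((one_lt_div (by positivity)).2 (by linarith)))

lemma exp_epsR {L sig : ℝ} (hL : 0 < L) (hsig : 0 < sig) :
    Real.exp (2 * L * epsR L sig) = (3 * sig + 1) / (sig + 1) := by
  rw [epsR, ← mul_assoc, mul_one_div_cancel (by positivity), one_mul, Real.exp_log (by positivity)]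

/-- The hypotheses give ψ(e) ≤ ‖e‖/σ ≤ ‖z‖; applying α₁ and α₁(‖z‖) ≤ V(z) gives the trigger
inequality. -/
lemma Plant.IsISS.cur_of_norm_le (h : P.IsISS) {c ρ sig : ℝ} (hc1 : c < 1) (hsig : 0 < sig)
    (hE : P.ErrBound c ρ sig) {z e : Euc n} (he : ‖e‖ ≤ 2 * ρ) (hez : ‖e‖ ≤ sig * ‖z‖) :
    P.Cur c z e := by
  have hlc : 0 < P.lam * (1 - c) := mul_pos h.lam_pos (by linarith)
  have hg : 0 ≤ P.gamma2 (4 * ‖e‖) := h.gamma2_kInf.1.nonneg (by positivity)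
  have h0 : 0 ≤ 1 / (P.lam * (1 - c)) * P.gamma2 (4 * ‖e‖) := by positivity
  have h1 : P.psi c e ≤ ‖z‖ := (hE e he).trans (by
    rw [one_div, inv_mul_le_iff₀ hsig]; exact hez)
  have h2 := (h.alpha1_kInf.1.mono (h.alpha1_kInf.kInv_nonneg h0) h1).trans (h.lower z)
  rw [h.alpha1_kInf.apply_kInv h0, one_div, inv_mul_le_iff₀ hlc] at h2
  exact h2

lemma Plant.IsISS.cur_zero (h : P.IsISS) {c : ℝ} (hc1 : c < 1) (z : Euc n) : P.Cur c z 0 := by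
  have hlc : 0 < P.lam * (1 - c) := mul_pos h.lam_pos (by linarith)
  have := h.V_nonneg z
  simp only [Plant.Cur, norm_zero, mul_zero, h.gamma2_kInf.1.2.2]
  positivity

/-- Here e = -z, so the field is bounded by 2L‖z‖ and Gronwall applies. The case v = 0 has to be
separated because the strict estimates for v ≠ 0 degenerate there. -/
lemma Plant.IsISS.heldFlow_zero (h : P.IsISS)
    (hF : LocallyLipschitz fun p : Euc n × Euc n => P.F p.1 p.2) {a b : ℝ} {z : ℝ → Euc n}
    (hz : P.HeldFlow 0 a b z) (hza : z a = 0) : ∀ s ∈ Icc a b, z s = 0 := by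
  obtain ⟨C, hC⟩ := isCompact_Icc.exists_bound_of_continuousOn hz.1
  intro s hs
  have hC0 : 0 ≤ C := (norm_nonneg _).trans (hC s hs)
  obtain ⟨L, hL, hLip⟩ := P.exists_fieldLip hF C
  have hB := hLip.fieldBound hC0 (h.F_zero hF)
  have h1 := norm_le_gronwallBound_of_norm_deriv_right_le (δ := 0) (K := 2 * L) (ε := 0) hz.1 hz.2
    (by simp [hza]) (fun r hr => by
      have hr' := hC r ⟨hr.1, hr.2.le⟩
      rw [P.f_eq_F]
      have := hB (z r) (0 - z r) hr' (by rw [zero_sub, norm_neg]; linarith)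
      rw [zero_sub, norm_neg] at this
      rw [zero_sub]
      linarith) s hs
  rw [gronwallBound_ε0, zero_mul] at h1
  exact norm_le_zero_iff.1 h1

/-- Along the flow that keeps the sample `v` the triggering condition is not violated before
`epsR` units of time have elapsed. -/
lemma Plant.IsISS.cur_before_epsR (h : P.IsISS)
    (hF : LocallyLipschitz fun p : Euc n × Euc n => P.F p.1 p.2) {c ρ L sig : ℝ}
    (hc0 : 0 < c) (hc1 : c < 1) (hρ : 0 ≤ ρ) (hL : 0 < L) (hsig : 0 < sig)
    (hFB : P.FieldBound ρ L) (hE : P.ErrBound c ρ sig) {v : Euc n} (hv : P.V v ≤ P.alpha1 ρ)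
    {a b : ℝ} {z : ℝ → Euc n} (hz : P.HeldFlow v a b z) (hza : z a = v)
    (hb : b < a + epsR L sig) : ∀ s ∈ Icc a b, P.Cur c (z s) (v - z s) := by
  have hnorm : ∀ y, P.V y ≤ P.V v → ‖y‖ ≤ ρ := fun y hy =>
    h.alpha1_kInf.1.le_of_apply_le (norm_nonneg y) hρ ((h.lower y).trans (hy.trans hv))
  rcases eq_or_ne v 0 with rfl | hv0
  · intro s hs
    rw [h.heldFlow_zero hF hz hza s hs, sub_zero]
    exact h.cur_zero hc1 0
  by_contra! hcon
  obtain ⟨s₁, hs₁, hbad₁⟩ := hcon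
  -- At the infimum of the violation times the condition will be shown to hold with room to spare, a
  -- contradiction.
  set B : Set ℝ := {s | s ∈ Icc a b ∧ ¬ P.Cur c (z s) (v - z s)}
  have hBne : B.Nonempty := ⟨s₁, hs₁, hbad₁⟩
  have hBbdd : BddBelow B := ⟨a, fun s hs => hs.1.1⟩
  set s₀ := sInf B
  have has₀ : a ≤ s₀ := le_csInf hBne fun s hs => hs.1.1
  have hs₀b : s₀ ≤ b := (csInf_le hBbdd ⟨hs₁, hbad₁⟩).trans hs₁.2
  have hcur : ∀ s ∈ Ico a s₀, P.Cur c (z s) (v - z s) := fun s hs => by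
    by_contra hs'
    exact absurd (csInf_le hBbdd ⟨⟨hs.1, hs.2.le.trans hs₀b⟩, hs'⟩) (not_le.2 hs.2)
  have hvpos : 0 < ‖v‖ := norm_pos_iff.2 hv0
  have hvρ : ‖v‖ ≤ ρ := hnorm v le_rfl
  -- Up to the first violation V decreases, so the flow remains where the linear bounds are
  -- available.
  have hzρ : ∀ s ∈ Icc a s₀, ‖z s‖ ≤ ρ := fun s hs => by
    refine hnorm _ ?_
    have h1 := h.decay_of_cur (hz.mono le_rfl (hs.2.trans hs₀b)) hs.1
      (fun r hr => hcur r ⟨hr.1, hr.2.trans_le hs.2⟩)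
    rw [hza] at h1
    refine h1.trans (mul_le_of_le_one_right (h.V_nonneg v) (Real.exp_le_one_iff.2 ?_))
    have := mul_nonneg (mul_nonneg hc0.le h.lam_pos.le) (sub_nonneg.2 hs.1)
    linarith
  -- From ‖z‖ ≤ ‖v‖ + ‖e‖ one gets ‖e'‖ ≤ L‖v‖ + 2L‖e‖; this is the origin of 2L in `epsR`.
  have hgr := norm_le_gronwallBound_of_norm_deriv_right_le (f := fun s => v - z s)
    (f' := fun s => -P.f (z s) (P.k v)) (δ := 0) (K := 2 * L) (ε := L * ‖v‖) (a := a) (b := s₀)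
    (continuousOn_const.sub (hz.mono le_rfl hs₀b).1)
    (fun s hs => ((hz.2 s ⟨hs.1, hs.2.trans_le hs₀b⟩).const_sub v)) (by simp [hza])
    (fun s hs => by
      have h1 := hzρ s ⟨hs.1, hs.2.le⟩
      have h2 := norm_sub_le v (z s)
      have h3 := hFB (z s) (v - z s) h1 (by linarith)
      have h4 : ‖z s‖ ≤ ‖v‖ + ‖v - z s‖ := by
        have := norm_sub_le v (v - z s)
        rwa [sub_sub_cancel] at this
      rw [norm_neg, P.f_eq_F]
      refine h3.trans ?_
      have := mul_le_mul_of_nonneg_left h4 hL.le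
      linarith) s₀ (right_mem_Icc.2 has₀)
  rw [gronwallBound_of_K_ne_0 (by positivity)] at hgr
  beta_reduce at hgr
  have hexp : Real.exp (2 * L * (s₀ - a)) < (3 * sig + 1) / (sig + 1) := by
    rw [← exp_epsR hL hsig]
    exact Real.exp_lt_exp.2 (mul_lt_mul_of_pos_left (by linarith) (by positivity))
  rw [lt_div_iff₀ (by positivity)] at hexp
  have hLv : L * ‖v‖ / (2 * L) = ‖v‖ / 2 := by field_simp
  rw [zero_mul, zero_add, hLv] at hgr
  set e₀ := ‖v - z s₀‖
  set X := Real.exp (2 * L * (s₀ - a))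
  -- The value of `epsR` is the time at which the Gronwall bound (‖v‖/2)(X - 1) reaches σ‖v‖/(σ +
  -- 1). Below it, ‖v‖ ≤ ‖z‖ + ‖e‖ yields ‖e‖ < σ‖z‖.
  have he : (sig + 1) * e₀ < sig * ‖v‖ := by
    calc (sig + 1) * e₀ ≤ (sig + 1) * (‖v‖ / 2 * (X - 1)) := by gcongr
      _ = ‖v‖ / 2 * (X * (sig + 1) - (sig + 1)) := by ring
      _ < ‖v‖ / 2 * ((3 * sig + 1) - (sig + 1)) := by gcongr
      _ = sig * ‖v‖ := by ring
  have hvz : ‖v‖ ≤ ‖z s₀‖ + e₀ := by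
    have := norm_add_le (z s₀) (v - z s₀)
    rwa [add_sub_cancel] at this
  have hez : e₀ < sig * ‖z s₀‖ := by
    have := mul_le_mul_of_nonneg_left hvz hsig.le
    linarith
  have he2 : e₀ < 2 * ρ := by
    by_contra hcon
    rw [not_lt] at hcon
    have : sig * ‖v‖ ≤ sig * e₀ := by gcongr; linarith
    have h0 : 0 ≤ e₀ := norm_nonneg _
    linarith
  have hcz : ContinuousWithinAt z (Icc a b) s₀ := hz.1 s₀ ⟨has₀, hs₀b⟩
  have hev : ∀ᶠ s in 𝓝[Icc a b] s₀, P.Cur c (z s) (v - z s) := by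
    have hce : ContinuousWithinAt (fun s => ‖v - z s‖) (Icc a b) s₀ :=
      (continuousWithinAt_const.sub hcz).norm
    filter_upwards [hce.eventually_lt continuousWithinAt_const he2,
      hce.eventually_lt (hcz.norm.const_mul sig) hez] with s h1 h2
    exact h.cur_of_norm_le hc1 hsig hE h1.le h2.le
  obtain ⟨η, hη, hsub⟩ := Metric.mem_nhdsWithin_iff.1 hev
  obtain ⟨s, hsB, hs⟩ := exists_lt_of_csInf_lt hBne (show s₀ < s₀ + η by linarith)
  refine hsB.2 (hsub ⟨?_, hsB.1⟩)
  have : s₀ ≤ s := csInf_le hBbdd hsB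
  rw [Metric.mem_ball, Real.dist_eq, abs_of_nonneg (by linarith)]
  linarith

lemma Plant.IsISS.add_epsR_le_nextSample (h : P.IsISS)
    (hF : LocallyLipschitz fun p : Euc n × Euc n => P.F p.1 p.2) {c ρ L sig : ℝ}
    (hc0 : 0 < c) (hc1 : c < 1) (hρ : 0 ≤ ρ) (hL : 0 < L) (hsig : 0 < sig)
    (hFB : P.FieldBound ρ L) (hE : P.ErrBound c ρ sig) {v : Euc n} (hv : P.V v ≤ P.alpha1 ρ)
    (a : ℝ) : (a : EReal) + (epsR L sig : EReal) ≤ P.nextSample c a v := by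
  refine le_sInf ?_
  rintro _ ⟨s, rfl, has, z, hza, hz, hcur⟩
  rw [← EReal.coe_add, EReal.coe_le_coe_iff]
  by_contra hlt
  exact hcur (h.cur_before_epsR hF hc0 hc1 hρ hL hsig hFB hE hv hz hza (not_le.1 hlt) s
    (right_mem_Icc.2 has.le))

lemma Plant.IsISS.lt_nextSample (h : P.IsISS)
    (hF : LocallyLipschitz fun p : Euc n × Euc n => P.F p.1 p.2) {c : ℝ}
    (hc0 : 0 < c) (hc1 : c < 1) (hpsi : LocallyLipschitz (P.psi c)) (a : ℝ) (v : Euc n) :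
    (a : EReal) < P.nextSample c a v := by
  have hV := h.V_nonneg v
  have hρ := h.alpha1_kInf.kInv_nonneg hV
  -- The radius is the one for which α₁ takes the value V(v).
  obtain ⟨L, hL, hLip⟩ := P.exists_fieldLip hF (kInv P.alpha1 (P.V v))
  obtain ⟨sig, hsig, hErr⟩ := P.exists_errLip hpsi (kInv P.alpha1 (P.V v))
  refine lt_of_lt_of_le ?_ (h.add_epsR_le_nextSample hF hc0 hc1 hρ hL hsig
    (hLip.fieldBound hρ (h.F_zero hF)) (hErr.errBound h hρ) (h.alpha1_kInf.apply_kInv hV).ge a)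
  rw [← EReal.coe_add, EReal.coe_lt_coe_iff]
  linarith [epsR_pos hL hsig]

/-! ## Duration of the attacks -/

lemma DoS.tauStar_le (D : DoS) (j : ℕ) : D.tauStar ≤ D.dur j :=
  ciInf_le ⟨0, by rintro _ ⟨i, rfl⟩; exact (D.dur_pos i).le⟩ j

lemma DoS.nonneg_of_mem_denied (D : DoS) {s : ℝ} (hs : s ∈ D.denied) : 0 ≤ s := by
  obtain ⟨j, hj⟩ := mem_iUnion.1 hs
  exact (D.h_nonneg j).trans hj.1

lemma DoS.volume_Xi_ne_top (D : DoS) (t : ℝ) : volume (D.Xi t) ≠ ⊤ :=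
  measure_ne_top_of_subset inter_subset_right (measure_Icc_lt_top (a := (0 : ℝ)) (b := t)).ne

/-- The instants that follow an instant of denial within less than `Del` units of time. -/
def DoS.shadow (D : DoS) (Del : ℝ) : Set ℝ := {r | ∃ s ∈ D.denied, s ≤ r ∧ r < s + Del}

/-- The instants up to `t` at which attacks end and communication becomes possible. -/
lemma DoS.exists_ends (D : DoS) (hD : Tendsto D.h atTop atTop) (t : ℝ) :
    ∃ E : Finset ℝ, ∀ p, p ∈ E ↔ p ∉ D.denied ∧ ∃ j, p = D.h j + D.dur j ∧ p ≤ t := by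
  classical
  obtain ⟨N, hN⟩ := eventually_atTop.1 (hD.eventually_gt_atTop t)
  refine ⟨((Finset.range N).image fun j => D.h j + D.dur j).filter
    fun p => p ∉ D.denied ∧ p ≤ t, fun p => ?_⟩
  simp only [Finset.mem_filter, Finset.mem_image, Finset.mem_range]
  constructor
  · rintro ⟨⟨j, -, rfl⟩, h1, h2⟩
    exact ⟨h1, j, rfl, h2⟩
  · rintro ⟨h1, j, rfl, h2⟩
    refine ⟨⟨j, ?_, rfl⟩, h1, h2⟩
    by_contra hj
    linarith [hN j (not_lt.1 hj), D.dur_pos j]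

/-- For a non-denied r in the shadow, consider among the finitely many attacks begun by time r the
one that ends last. Its end p is not denied, since an attack containing p would end later still, and
p ≤ r. Moreover p lies after the denied instant s that casts the shadow, so r < s + Δ_* < p + Δ_*.
-/
lemma DoS.shadow_subset (D : DoS) (hD : Tendsto D.h atTop atTop) {Del t : ℝ} {E : Finset ℝ}
    (hE : ∀ p, p ∈ E ↔ p ∉ D.denied ∧ ∃ j, p = D.h j + D.dur j ∧ p ≤ t) :
    D.shadow Del ∩ Icc 0 t ⊆ D.Xi t ∪ ⋃ p ∈ E, Icc p (p + Del) := by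
  rintro r ⟨⟨s, hs, hsr, hrs⟩, hr⟩
  by_cases hrd : r ∈ D.denied
  · exact Or.inl ⟨hrd, hr⟩
  right
  obtain ⟨j, hj⟩ := mem_iUnion.1 hs
  have hout : ∀ i, D.h i ≤ r → D.h i + D.dur i ≤ r := fun i hi => by
    by_contra hcon
    exact hrd (mem_iUnion.2 ⟨i, hi, not_le.1 hcon⟩)
  obtain ⟨N, hN⟩ := eventually_atTop.1 (hD.eventually_gt_atTop r)
  obtain ⟨i, hi, hmax⟩ := ((Finset.range N).filter fun i => D.h i ≤ r).exists_max_image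
    (fun i => D.h i + D.dur i) ⟨j, by
      simp only [Finset.mem_filter, Finset.mem_range]
      refine ⟨?_, hj.1.trans hsr⟩
      by_contra hcon
      linarith [hN j (not_lt.1 hcon), hj.1]⟩
  simp only [Finset.mem_filter, Finset.mem_range] at hi hmax
  have hmax' : ∀ k, D.h k ≤ r → D.h k + D.dur k ≤ D.h i + D.dur i := fun k hk =>
    hmax k ⟨by
      by_contra hcon
      linarith [hN k (not_lt.1 hcon)], hk⟩
  have hir := hout i hi.2
  refine mem_iUnion₂.2 ⟨D.h i + D.dur i, (hE _).2 ⟨fun hd => ?_, i, rfl, hir.trans hr.2⟩, hir, ?_⟩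
  · obtain ⟨k, hk⟩ := mem_iUnion.1 hd
    linarith [hmax' k (hk.1.trans hir), hk.2]
  · linarith [hmax' j (hj.1.trans hsr), hj.2]

/-- Each such end is preceded by a denied interval of length τ_*. These intervals are disjoint: the
attack ending at q contains no earlier end p, which is not denied. -/
lemma DoS.card_ends_mul_le (D : DoS) (hdur : 0 < D.tauStar) {t : ℝ} {E : Finset ℝ}
    (hE : ∀ p, p ∈ E ↔ p ∉ D.denied ∧ ∃ j, p = D.h j + D.dur j ∧ p ≤ t) :
    E.card * D.tauStar ≤ volume.real (D.Xi t) := by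
  have hlt : ∀ p ∈ E, ∀ q ∈ E, p < q → p ≤ q - D.tauStar := by
    intro p hp q hq hpq
    obtain ⟨-, j, rfl, -⟩ := (hE q).1 hq
    by_contra hcon
    exact ((hE p).1 hp).1 (mem_iUnion.2 ⟨j, by linarith [D.tauStar_le j], hpq⟩)
  have hdisj : PairwiseDisjoint (↑E) fun p : ℝ => Ico (p - D.tauStar) p := by
    intro p hp q hq hpq
    refine Set.disjoint_left.2 fun r hr hr' => ?_
    rcases lt_or_gt_of_ne hpq with h | h
    · linarith [hlt p hp q hq h, hr.2, hr'.1]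
    · linarith [hlt q hq p hp h, hr'.2, hr.1]
  have h1 := measureReal_biUnion_finset (μ := volume) hdisj (fun p _ => measurableSet_Ico)
    (fun p _ => (measure_Ico_lt_top).ne)
  have h2 : volume.real (⋃ p ∈ E, Ico (p - D.tauStar) p) ≤ volume.real (D.Xi t) := by
    refine measureReal_mono (iUnion₂_subset fun p hp r hr => ?_) (D.volume_Xi_ne_top t)
    obtain ⟨-, j, rfl, hjt⟩ := (hE p).1 hp
    have h3 : D.h j ≤ r := by linarith [D.tauStar_le j, hr.1]
    exact ⟨mem_iUnion.2 ⟨j, h3, hr.2⟩, (D.h_nonneg j).trans h3, hr.2.le.trans hjt⟩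
  rw [h1] at h2
  simpa [Real.volume_real_Ico, hdur.le] using h2

lemma DoS.volume_shadow_le (D : DoS) (hD : Tendsto D.h atTop atTop) (hdur : 0 < D.tauStar)
    {Del : ℝ} (hDel : 0 ≤ Del) (t : ℝ) :
    volume.real (D.shadow Del ∩ Icc 0 t) ≤ (1 + Del / D.tauStar) * volume.real (D.Xi t) := by
  obtain ⟨E, hE⟩ := D.exists_ends hD t
  have h1 : volume.real (⋃ p ∈ E, Icc p (p + Del)) ≤ E.card * Del := by
    refine (measureReal_biUnion_finset_le E _).trans ?_
    simp [Real.volume_real_Icc, hDel]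
  have h2 := D.card_ends_mul_le hdur hE
  have hfin : volume (D.Xi t ∪ ⋃ p ∈ E, Icc p (p + Del)) ≠ ⊤ :=
    (measure_union_lt_top (D.volume_Xi_ne_top t).lt_top
      ((measure_biUnion_lt_top E.finite_toSet fun p _ => measure_Icc_lt_top))).ne
  calc volume.real (D.shadow Del ∩ Icc 0 t)
      ≤ volume.real (D.Xi t ∪ ⋃ p ∈ E, Icc p (p + Del)) :=
        measureReal_mono (D.shadow_subset hD hE) hfin
    _ ≤ volume.real (D.Xi t) + volume.real (⋃ p ∈ E, Icc p (p + Del)) := measureReal_union_le _ _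
    _ ≤ volume.real (D.Xi t) + (E.card * D.tauStar) * (Del / D.tauStar) := by
        rw [mul_assoc, mul_div_cancel₀ _ hdur.ne']
        gcongr
    _ ≤ volume.real (D.Xi t) + volume.real (D.Xi t) * (Del / D.tauStar) := by gcongr
    _ = _ := by ring

/-! ## The held sample -/

lemma held_congr {D : DoS} {t t' : ℕ → EReal} {x x' : ℝ → Euc n} {s s' : ℝ}
    (hset : {k : ℕ | ∃ r ∈ D.Theta s, t k = (r : EReal)} =
      {k : ℕ | ∃ r ∈ D.Theta s', t' k = (r : EReal)})
    (hbdd : BddAbove {k : ℕ | ∃ r ∈ D.Theta s, t k = (r : EReal)})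
    (hx : ∀ k, ∀ r ∈ D.Theta s, t k = (r : EReal) → x (t k).toReal = x' (t' k).toReal) :
    held D t x s = held D t' x' s' := by
  classical
  unfold held
  rw [← hset]
  split_ifs with hne
  · obtain ⟨r, hr, hk⟩ := Nat.sSup_mem hne hbdd
    exact hx _ r hr hk
  · rfl

section Solution

variable {c : ℝ} {D : DoS} {x₀ : Euc n} {T : EReal} {t : ℕ → EReal} {x : ℝ → Euc n}

lemma IsSolution.t_nonneg (hs : IsSolution P c D x₀ T t x) (k : ℕ) : 0 ≤ t k :=
  hs.t_zero ▸ hs.t_mono (Nat.zero_le k)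

lemma IsSolution.nonneg_of_eq (hs : IsSolution P c D x₀ T t x) {k : ℕ} {a : ℝ}
    (ha : t k = (a : EReal)) : 0 ≤ a := by
  have h := hs.t_nonneg k
  rw [ha] at h
  exact_mod_cast h

lemma IsSolution.exists_real (hs : IsSolution P c D x₀ T t x) {k : ℕ} (hk : t k < T) :
    ∃ a : ℝ, t k = (a : EReal) ∧ 0 ≤ a ∧ (a : EReal) < T := by
  have h0 := hs.t_nonneg k
  lift t k to ℝ using ⟨hk.ne_top, (lt_of_lt_of_le (by exact EReal.bot_lt_zero) h0).ne'⟩ with a ha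
  exact ⟨a, rfl, by exact_mod_cast h0, hk⟩

/-- Boundedness matters because `sSup` of an unbounded set of naturals is 0, which would make `held`
return the wrong sample. -/
lemma bddAbove_of_lt (ht : Monotone t) {s : ℝ} {K : ℕ} (hK : (s : EReal) < t (K + 1)) :
    BddAbove {k : ℕ | ∃ r ∈ D.Theta s, t k = (r : EReal)} := by
  refine ⟨K, ?_⟩
  rintro k ⟨r, hr, hk⟩
  by_contra hcon
  have h1 := hK.trans_le (ht (Nat.succ_le_of_lt (not_le.1 hcon)))
  rw [hk, EReal.coe_lt_coe_iff] at h1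
  exact absurd hr.1.2 (not_le.2 h1)

lemma IsSolution.bddAbove (hs : IsSolution P c D x₀ T t x) {s : ℝ} (h0 : 0 ≤ s)
    (hsT : (s : EReal) < T) : BddAbove {k : ℕ | ∃ r ∈ D.Theta s, t k = (r : EReal)} :=
  let ⟨_, _, hK⟩ := hs.cover s h0 hsT
  bddAbove_of_lt hs.t_mono hK

lemma held_eq_of_success (ht : Monotone t) {k : ℕ} {s : ℝ}
    (h0 : 0 ≤ s) (hbdd : BddAbove {k : ℕ | ∃ r ∈ D.Theta s, t k = (r : EReal)})
    (hk : t k = (s : EReal)) (hsd : s ∉ D.denied) : held D t x s = x s := by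
  classical
  have hmem : k ∈ {k : ℕ | ∃ r ∈ D.Theta s, t k = (r : EReal)} := ⟨s, ⟨⟨h0, le_rfl⟩, hsd⟩, hk⟩
  obtain ⟨r, hr, hsup⟩ := Nat.sSup_mem ⟨k, hmem⟩ hbdd
  -- Several attempts may share the instant s, so the last index can exceed k; its time is still s.
  have h1 := ht (le_csSup hbdd hmem)
  unfold held
  rw [if_pos ⟨k, hmem⟩]
  rw [hk, hsup, EReal.coe_le_coe_iff] at h1
  rw [hsup, EReal.toReal_coe, le_antisymm hr.1.2 h1]

lemma held_eq_of_forall_denied {a s : ℝ} (has : a ≤ s)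
    (hbdd : BddAbove {k : ℕ | ∃ r ∈ D.Theta s, t k = (r : EReal)})
    (h : ∀ (j : ℕ) (r : ℝ), t j = (r : EReal) → a < r → r ≤ s → r ∈ D.denied) :
    held D t x s = held D t x a := by
  refine held_congr ?_ hbdd fun _ _ _ _ => rfl
  ext k
  constructor
  · rintro ⟨r, hr, hk⟩
    refine ⟨r, ⟨⟨hr.1.1, ?_⟩, hr.2⟩, hk⟩
    by_contra hcon
    exact hr.2 (h k r hk (not_le.1 hcon) hr.1.2)
  · rintro ⟨r, hr, hk⟩
    exact ⟨r, ⟨⟨hr.1.1, hr.1.2.trans has⟩, hr.2⟩, hk⟩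

lemma held_eq_of_lt (ht : Monotone t) {k : ℕ} {a s : ℝ} (hk : t k ≤ (a : EReal)) (has : a ≤ s)
    (hsk : (s : EReal) < t (k + 1)) : held D t x s = held D t x a := by
  refine held_eq_of_forall_denied has (bddAbove_of_lt ht hsk) fun j r hj har hrs => ?_
  exfalso
  rcases le_or_gt j k with hjk | hjk
  · have h1 := (ht hjk).trans hk
    rw [hj, EReal.coe_le_coe_iff] at h1
    linarith
  · have h1 := hsk.trans_le (ht (Nat.succ_le_of_lt hjk))
    rw [hj, EReal.coe_lt_coe_iff] at h1
    linarith

/-- The only instant after a and up to b at which an attempt is made is b, and that attempt fails.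
-/
lemma IsSolution.held_eq_of_denied (hs : IsSolution P c D x₀ T t x) {k : ℕ} {a b : ℝ}
    (ha : t k = (a : EReal)) (hb : t (k + 1) = (b : EReal)) (hbT : (b : EReal) < T)
    (hbd : b ∈ D.denied) : held D t x b = held D t x a := by
  have hab : a ≤ b := by
    have := hs.t_mono k.le_succ
    rw [ha, hb] at this
    exact_mod_cast this
  refine held_eq_of_forall_denied hab (hs.bddAbove ((hs.nonneg_of_eq ha).trans hab) hbT)
    fun j r hj har hrb => ?_
  rcases le_or_gt j k with hjk | hjk
  · have h1 := hs.t_mono hjk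
    rw [hj, ha, EReal.coe_le_coe_iff] at h1
    linarith
  · have h1 := hs.t_mono (Nat.succ_le_of_lt hjk)
    rw [Nat.succ_eq_add_one, hj, hb, EReal.coe_le_coe_iff] at h1
    rwa [le_antisymm hrb h1]

lemma IsSolution.heldFlow (hs : IsSolution P c D x₀ T t x) {k : ℕ} {a b : ℝ}
    (ha : t k = (a : EReal)) (hbT : (b : EReal) < T) (hb : (b : EReal) ≤ t (k + 1)) :
    P.HeldFlow (held D t x a) a b x := by
  have h0 := hs.nonneg_of_eq ha
  have hlt : ∀ s : ℝ, s ≤ b → (s : EReal) < T := fun s hsb =>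
    (EReal.coe_le_coe_iff.2 hsb).trans_lt hbT
  refine ⟨hs.cont.mono fun s hs' => ⟨h0.trans hs'.1, hlt s hs'.2⟩, fun s hs' => ?_⟩
  rw [← held_eq_of_lt hs.t_mono ha.le hs'.1 ((EReal.coe_lt_coe_iff.2 hs'.2).trans_le hb)]
  exact hs.ode s (h0.trans hs'.1) (hlt s hs'.2.le)

/-- Between a successful transmission and the next attempt the triggering condition holds. -/
lemma IsSolution.cur (hs : IsSolution P c D x₀ T t x) (h : P.IsISS) (hc1 : c < 1) {k : ℕ} {a s : ℝ}
    (ha : t k = (a : EReal)) (had : a ∉ D.denied) (has : a ≤ s) (hsT : (s : EReal) < T)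
    (hsk : (s : EReal) < t (k + 1)) : P.Cur c (x s) (x a - x s) := by
  rcases has.eq_or_lt with rfl | has'
  · rw [sub_self]
    exact h.cur_zero hc1 _
  have h0 := hs.nonneg_of_eq ha
  have haT : (a : EReal) < T := (EReal.coe_le_coe_iff.2 has).trans_lt hsT
  by_contra hcon
  refine absurd hsk (not_lt.2 ?_)
  rw [hs.trigger k a ha haT had]
  -- The solution itself is a flow that keeps the sample, so a violation at s would put the next
  -- attempt at s or earlier.
  refine sInf_le ⟨s, rfl, has', x, rfl, ?_, hcon⟩
  have := hs.heldFlow ha hsT hsk.le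
  rwa [held_eq_of_success hs.t_mono h0 (hs.bddAbove h0 haT) ha had] at this

lemma deltaStar_le_iff {Del : ℝ} : deltaStar D T t ≤ (Del : EReal) ↔
    ∀ (k : ℕ) (s : ℝ), t k = (s : EReal) → (s : EReal) < T → s ∈ D.denied →
      t (k + 1) ≤ (s : EReal) + (Del : EReal) := by
  have key : ∀ (k : ℕ) (s : ℝ), t k = (s : EReal) →
      (t (k + 1) - t k ≤ (Del : EReal) ↔ t (k + 1) ≤ (s : EReal) + (Del : EReal)) := fun k s hk => by
    rw [hk, EReal.sub_le_iff_le_add (Or.inl (EReal.coe_ne_bot s)) (Or.inl (EReal.coe_ne_top s)),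
      add_comm (Del : EReal)]
  simp only [deltaStar, iSup_le_iff, attempts, mem_ofPred_eq]
  constructor
  · intro h k s hk hsT hsd
    obtain ⟨j, hj⟩ := mem_iUnion.1 hsd
    exact (key k s hk).1 (h j k ⟨hk ▸ hsT, s, hj, hk⟩)
  · rintro h j k ⟨hkT, s, hj, hk⟩
    exact (key k s hk).2 (h k s hk (hk ▸ hkT) (mem_iUnion.2 ⟨j, hj⟩))

end Solution

/-! ## The exponential bound -/

/-- The time up to `r` spent in the shadow of an attack. -/
noncomputable def DoS.shadowTime (D : DoS) (Del r : ℝ) : ℝ :=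
  volume.real (D.shadow Del ∩ Icc 0 r)

lemma DoS.volume_shadow_ne_top (D : DoS) (Del r : ℝ) : volume (D.shadow Del ∩ Icc 0 r) ≠ ⊤ :=
  measure_ne_top_of_subset inter_subset_right (measure_Icc_lt_top (a := (0 : ℝ)) (b := r)).ne

lemma DoS.shadowTime_mono (D : DoS) (Del : ℝ) : Monotone (D.shadowTime Del) := fun _ b hab =>
  measureReal_mono (inter_subset_inter_right _ (Icc_subset_Icc_right hab))
    (D.volume_shadow_ne_top Del b)

/-- The shadow fills the interval between a denied attempt and the next one. -/
lemma DoS.shadowTime_add_le (D : DoS) {Del a b : ℝ} (ha : a ∈ D.denied) (hab : a ≤ b)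
    (hb : b ≤ a + Del) : D.shadowTime Del a + (b - a) ≤ D.shadowTime Del b := by
  have h0 := D.nonneg_of_mem_denied ha
  have h1 : D.shadow Del ∩ Icc 0 a ∪ Ioo a b ⊆ D.shadow Del ∩ Icc 0 b := by
    rintro r (⟨h1, h2⟩ | hr)
    · exact ⟨h1, h2.1, h2.2.trans hab⟩
    · exact ⟨⟨a, ha, hr.1.le, hr.2.trans_le hb⟩, h0.trans hr.1.le, hr.2.le⟩
  have hdisj : Disjoint (D.shadow Del ∩ Icc 0 a) (Ioo a b) :=
    Set.disjoint_left.2 fun r hr hr' => not_lt.2 hr.2.2 hr'.1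
  have h2 := measureReal_mono (μ := volume) h1 (D.volume_shadow_ne_top Del b)
  rw [measureReal_union hdisj measurableSet_Ioo (D.volume_shadow_ne_top Del a)
    measure_Ioo_lt_top.ne, Real.volume_real_Ioo_of_le hab] at h2
  exact h2

/-- The bound on the Lyapunov function that results from decay at the rate `p` outside the shadow
of the attacks and growth at the rate `q` inside. -/
noncomputable def DoS.envelope (D : DoS) (A p q Del r : ℝ) : ℝ :=
  A * Real.exp (-p * r + (p + q) * D.shadowTime Del r)

section Envelope

variable {D : DoS} {A p q Del a b : ℝ}

lemma DoS.envelope_pos (hA : 0 < A) (r : ℝ) : 0 < D.envelope A p q Del r := by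
  unfold DoS.envelope
  positivity

lemma DoS.decay_le_envelope (hA : 0 < A) (hp : 0 ≤ p) (hq : 0 ≤ q) (hab : a ≤ b) :
    D.envelope A p q Del a * Real.exp (-p * (b - a)) ≤ D.envelope A p q Del b := by
  rw [DoS.envelope, DoS.envelope, mul_assoc, ← Real.exp_add]
  have := mul_le_mul_of_nonneg_left (D.shadowTime_mono Del hab) (add_nonneg hp hq)
  refine mul_le_mul_of_nonneg_left (Real.exp_le_exp.2 ?_) hA.le
  linarith

/-- In the shadow the exponent has slope -p + (p + q) = q. -/
lemma DoS.growth_le_envelope (hA : 0 < A) (hp : 0 ≤ p) (hq : 0 ≤ q) (ha : a ∈ D.denied)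
    (hab : a ≤ b) (hb : b ≤ a + Del) :
    D.envelope A p q Del a * Real.exp (q * (b - a)) ≤ D.envelope A p q Del b := by
  rw [DoS.envelope, DoS.envelope, mul_assoc, ← Real.exp_add]
  have := mul_le_mul_of_nonneg_left (D.shadowTime_add_le ha hab hb) (add_nonneg hp hq)
  refine mul_le_mul_of_nonneg_left (Real.exp_le_exp.2 ?_) hA.le
  linarith

end Envelope

section Solution

variable {c mu Del : ℝ} {D : DoS} {x₀ : Euc n} {T : EReal} {t : ℕ → EReal} {x : ℝ → Euc n}

/-- Either the Lyapunov function decays, or it grows at most at the rate `2 mu`. -/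
lemma IsSolution.V_le_envelope_of_attempt (hs : IsSolution P c D x₀ T t x) (h : P.IsISS)
    (hc0 : 0 < c) (hc1 : c < 1) (hmu : 0 < mu) (hdel : deltaStar D T t ≤ (Del : EReal))
    {A : ℝ} (hA : 0 < A) {k : ℕ} {a b : ℝ} (ha : t k = (a : EReal)) (hab : a ≤ b)
    (hbT : (b : EReal) < T) (hb : (b : EReal) ≤ t (k + 1))
    (hV : P.V (x a) ≤ D.envelope A (c * P.lam) (2 * mu) Del a)
    (hheld : a ∈ D.denied → ∀ y, P.gamma2 ‖held D t x a - y‖ ≤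
      mu * P.V y + (mu + P.lam * (1 - c)) * D.envelope A (c * P.lam) (2 * mu) Del a) :
    P.V (x b) ≤ D.envelope A (c * P.lam) (2 * mu) Del b := by
  have haT : (a : EReal) < T := (EReal.coe_le_coe_iff.2 hab).trans_lt hbT
  have hp : 0 ≤ c * P.lam := (mul_pos hc0 h.lam_pos).le
  have hflow := hs.heldFlow ha hbT hb
  by_cases had : a ∈ D.denied
  · have h1 := h.growth hc0 hmu (D.envelope_pos hA a) hflow hab (hheld had) hV
    refine h1.trans (DoS.growth_le_envelope hA hp (by positivity) had hab ?_)
    have h2 := hb.trans (deltaStar_le_iff.1 hdel k a ha haT had)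
    exact_mod_cast h2
  · have h0 := hs.nonneg_of_eq ha
    rw [held_eq_of_success hs.t_mono h0 (hs.bddAbove h0 haT) ha had] at hflow
    have h1 := h.decay_of_cur (c := c) hflow hab fun s hs' =>
      hs.cur h hc1 ha had hs'.1 ((EReal.coe_lt_coe_iff.2 hs'.2).trans hbT)
        ((EReal.coe_lt_coe_iff.2 hs'.2).trans_le hb)
    refine h1.trans (le_trans ?_ (DoS.decay_le_envelope hA hp (by positivity) hab))
    gcongr

/-- The triggering condition still holds at the attempt that follows a success. -/
lemma IsSolution.cur_right (hs : IsSolution P c D x₀ T t x) (h : P.IsISS) (hc1 : c < 1) {k : ℕ}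
    {a b : ℝ} (ha : t k = (a : EReal)) (had : a ∉ D.denied) (hab : a ≤ b)
    (hbT : (b : EReal) < T) (hb : (b : EReal) ≤ t (k + 1)) : P.Cur c (x b) (x a - x b) := by
  rcases hab.eq_or_lt with rfl | hab'
  · rw [sub_self]
    exact h.cur_zero hc1 _
  have hx := (hs.heldFlow ha hbT hb).1
  have hclos : b ∈ closure (Ico a b) := by
    rw [closure_Ico hab'.ne]
    exact right_mem_Icc.2 hab
  have hbot : (𝓝[Ico a b] b).NeBot := mem_closure_iff_nhdsWithin_neBot.1 hclos
  have hxb : Tendsto x (𝓝[Ico a b] b) (𝓝 (x b)) :=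
    (hx b (right_mem_Icc.2 hab)).mono Ico_subset_Icc_self
  -- The absolute value makes γ₂, known to be continuous only on [0, ∞), continuous on ℝ.
  have hcont : Continuous fun r => P.gamma2 (4 * |r|) := by
    rw [← continuousOn_univ]
    exact h.gamma2_kInf.1.1.comp (by fun_prop) fun r _ => mem_Ici.2 (by positivity)
  have hl : Tendsto (fun s => P.gamma2 (4 * ‖x a - x s‖)) (𝓝[Ico a b] b)
      (𝓝 (P.gamma2 (4 * ‖x a - x b‖))) := by
    have := (hcont.tendsto ‖x a - x b‖).comp (tendsto_const_nhds.sub hxb).norm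
    simpa only [Function.comp_def, abs_norm] using this
  have hr : Tendsto (fun s => P.lam * (1 - c) * P.V (x s)) (𝓝[Ico a b] b)
      (𝓝 (P.lam * (1 - c) * P.V (x b))) :=
    ((h.V_continuous.tendsto (x b)).comp hxb).const_mul _
  refine le_of_tendsto_of_tendsto hl hr ?_
  filter_upwards [self_mem_nhdsWithin] with s hs'
  exact hs.cur h hc1 ha had hs'.1 ((EReal.coe_lt_coe_iff.2 hs'.2).trans hbT)
    ((EReal.coe_lt_coe_iff.2 hs'.2).trans_le hb)

lemma Plant.IsISS.gamma2_norm_le (h : P.IsISS) (hmu : 0 < mu)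
    (hA2 : ∀ r, 0 ≤ r → P.gamma2 (4 * r) ≤ mu * P.alpha1 r) (y : Euc n) :
    P.gamma2 (4 * ‖y‖) ≤ mu * P.V y :=
  (hA2 _ (norm_nonneg y)).trans (mul_le_mul_of_nonneg_left (h.lower y) hmu.le)

lemma held_zero_of_denied (h0 : 0 ∈ D.denied) :
    held D t x 0 = 0 := by
  classical
  unfold held
  rw [if_neg]
  rintro ⟨k, r, hr, -⟩
  have : r = 0 := le_antisymm hr.1.2 hr.1.1
  exact hr.2 (this ▸ h0)

/-- The second conjunct is the hypothesis of `Plant.IsISS.growth` with M the envelope. It must be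
carried along because a sample may stay in use through many consecutive denied attempts. -/
lemma IsSolution.envelope_invariant (hs : IsSolution P c D x₀ T t x) (h : P.IsISS)
    (hc0 : 0 < c) (hc1 : c < 1) (hmu : 0 < mu)
    (hA2 : ∀ r, 0 ≤ r → P.gamma2 (4 * r) ≤ mu * P.alpha1 r)
    (hdel : deltaStar D T t ≤ (Del : EReal)) {A : ℝ} (hA : 0 < A) (hV0 : P.V x₀ ≤ A) (k : ℕ) :
    ∀ a : ℝ, t k = (a : EReal) → (a : EReal) < T →
      P.V (x a) ≤ D.envelope A (c * P.lam) (2 * mu) Del a ∧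
      (a ∈ D.denied → ∀ y, P.gamma2 ‖held D t x a - y‖ ≤
        mu * P.V y + (mu + P.lam * (1 - c)) * D.envelope A (c * P.lam) (2 * mu) Del a) := by
  have hp : 0 ≤ c * P.lam := (mul_pos hc0 h.lam_pos).le
  have hl : 0 ≤ P.lam * (1 - c) := mul_nonneg h.lam_pos.le (by linarith)
  induction k with
  | zero =>
    intro a ha haT
    have ha0 : a = 0 := by
      rw [hs.t_zero] at ha
      exact_mod_cast ha.symm
    subst ha0
    refine ⟨?_, fun had y => ?_⟩
    · rw [hs.init]
      refine hV0.trans (le_mul_of_one_le_right hA.le (Real.one_le_exp ?_))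
      have : 0 ≤ D.shadowTime Del 0 := measureReal_nonneg
      rw [mul_zero, zero_add]
      positivity
    · rw [held_zero_of_denied had, zero_sub, norm_neg]
      have h1 := h.gamma2_kInf.1.mono (norm_nonneg y)
        (by linarith [norm_nonneg y] : ‖y‖ ≤ 4 * ‖y‖)
      have h2 := h.gamma2_norm_le hmu hA2 y
      have h3 : 0 ≤ (mu + P.lam * (1 - c)) * D.envelope A (c * P.lam) (2 * mu) Del 0 :=
        mul_nonneg (by linarith) (D.envelope_pos hA 0).le
      linarith
  | succ k ih =>
    intro b hb hbT
    obtain ⟨a, ha, -, haT⟩ := hs.exists_real ((hs.t_mono k.le_succ).trans_lt (hb ▸ hbT))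
    have hab : a ≤ b := by
      have := hs.t_mono k.le_succ
      rw [ha, hb] at this
      exact_mod_cast this
    obtain ⟨hVa, hha⟩ := ih a ha haT
    have hVb := hs.V_le_envelope_of_attempt h hc0 hc1 hmu hdel hA ha hab hbT hb.ge hVa hha
    refine ⟨hVb, fun hbd y => ?_⟩
    rw [hs.held_eq_of_denied ha hb hbT hbd]
    by_cases had : a ∈ D.denied
    -- Two denials in a row: the sample is unchanged, and the envelope increases in between.
    · refine (hha had y).trans ?_
      have hle := deltaStar_le_iff.1 hdel k a ha haT had
      rw [hb] at hle
      have h1 := DoS.growth_le_envelope (p := c * P.lam) (q := 2 * mu) hA hp (by positivity) had hab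
        (by exact_mod_cast hle : b ≤ a + Del)
      have h2 : D.envelope A (c * P.lam) (2 * mu) Del a ≤
          D.envelope A (c * P.lam) (2 * mu) Del b := by
        refine le_trans (le_mul_of_one_le_right (D.envelope_pos hA a).le (Real.one_le_exp ?_)) h1
        exact mul_nonneg (by positivity) (sub_nonneg.2 hab)
      gcongr
    · have h0 := hs.nonneg_of_eq ha
      rw [held_eq_of_success hs.t_mono h0 (hs.bddAbove h0 haT) ha had]
      -- First denial after a success: x(a) - y is split into x(a) - x(b), x(b) and y. The trigger
      -- bounds the first piece, μV the other two.
      have h1 := hs.cur_right h hc1 ha had hab hbT hb.ge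
      have h2 := h.gamma2_norm_le hmu hA2 y
      have h3 := h.gamma2_norm_le hmu hA2 (x b)
      have h4 := h.gamma2_kInf.1.apply_add_add_le (norm_nonneg (x a - x b)) (norm_nonneg (x b))
        (norm_nonneg y)
      have h5 : ‖x a - y‖ ≤ ‖x a - x b‖ + ‖x b‖ + ‖y‖ := by
        have h6 := norm_add_le (x a - x b) (x b)
        have h7 := norm_sub_le (x a) y
        rw [sub_add_cancel] at h6
        linarith
      have h8 := h.gamma2_kInf.1.mono (norm_nonneg _) h5
      have h9 := mul_le_mul_of_nonneg_left hVb hmu.le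
      have h10 := mul_le_mul_of_nonneg_left hVb hl
      unfold Plant.Cur at h1
      linarith

/-- The Lyapunov function along a solution. -/
lemma IsSolution.V_le (hs : IsSolution P c D x₀ T t x) (h : P.IsISS)
    (hc0 : 0 < c) (hc1 : c < 1) (hmu : 0 < mu)
    (hA2 : ∀ r, 0 ≤ r → P.gamma2 (4 * r) ≤ mu * P.alpha1 r)
    {kap tau : ℝ} (hA1 : D.IsSlow kap tau) (hdur : 0 < D.tauStar) (hDel : 0 ≤ Del)
    (hdel : deltaStar D T t ≤ (Del : EReal)) {s : ℝ} (h0 : 0 ≤ s) (hsT : (s : EReal) < T) :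
    P.V (x s) ≤ gam kap P.lam mu Del D.tauStar *
      Real.exp (-bet c P.lam mu tau Del D.tauStar * s) * P.V x₀ := by
  have hlam := h.lam_pos
  obtain ⟨k, hk, hk'⟩ := hs.cover s h0 hsT
  obtain ⟨a, ha, ha0, haT⟩ := hs.exists_real (hk.trans_lt hsT)
  have has : a ≤ s := by
    rw [ha] at hk
    exact_mod_cast hk
  set G := gam kap P.lam mu Del D.tauStar * Real.exp (-bet c P.lam mu tau Del D.tauStar * s)
    with hG
  have hGpos : 0 < G := mul_pos (Real.exp_pos _) (Real.exp_pos _)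
  have hexp : Real.exp (-(c * P.lam) * s + (c * P.lam + 2 * mu) * D.shadowTime Del s) ≤ G := by
    rw [hG, gam, ← Real.exp_add, Real.exp_le_exp]
    have h1 := D.volume_shadow_le hA1.1 hdur hDel s
    have h2 := hA1.2.2.2 s h0
    have h3 : 0 ≤ 1 + Del / D.tauStar := by positivity
    have h4 : D.shadowTime Del s ≤ (1 + Del / D.tauStar) * (kap + s / tau) :=
      h1.trans (mul_le_mul_of_nonneg_left h2 h3)
    have h5 : 0 ≤ D.shadowTime Del s := measureReal_nonneg
    -- Replacing cλ by λ here produces the factor λ + 2μ in γ and β.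
    have h6 : (c * P.lam + 2 * mu) * D.shadowTime Del s ≤
        (P.lam + 2 * mu) * ((1 + Del / D.tauStar) * (kap + s / tau)) := by
      gcongr
      nlinarith
    calc -(c * P.lam) * s + (c * P.lam + 2 * mu) * D.shadowTime Del s
        ≤ -(c * P.lam) * s + (P.lam + 2 * mu) * ((1 + Del / D.tauStar) * (kap + s / tau)) := by
          linarith
      _ = _ := by
          unfold bet
          ring
  -- V(x₀) may vanish while the envelope needs a positive amplitude, so larger amplitudes are used
  -- and then lowered to V(x₀).
  have key : ∀ A : ℝ, P.V x₀ < A → P.V (x s) ≤ G * A := fun A hA => by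
    have hApos : 0 < A := (h.V_nonneg x₀).trans_lt hA
    obtain ⟨hVa, hha⟩ := hs.envelope_invariant h hc0 hc1 hmu hA2 hdel hApos hA.le k a ha haT
    refine (hs.V_le_envelope_of_attempt h hc0 hc1 hmu hdel hApos ha has hsT hk'.le hVa hha).trans ?_
    rw [DoS.envelope, mul_comm]
    gcongr
  have h1 : P.V (x s) / G ≤ P.V x₀ := le_of_forall_gt_imp_ge_of_dense fun A hA => by
    rw [div_le_iff₀ hGpos, mul_comm]
    exact key A hA
  rwa [div_le_iff₀ hGpos, mul_comm] at h1

lemma gam_pos (kap lam mu Del tauS : ℝ) : 0 < gam kap lam mu Del tauS := Real.exp_pos _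

lemma IsSolution.norm_le (hs : IsSolution P c D x₀ T t x) (h : P.IsISS)
    (hc0 : 0 < c) (hc1 : c < 1) (hmu : 0 < mu)
    (hA2 : ∀ r, 0 ≤ r → P.gamma2 (4 * r) ≤ mu * P.alpha1 r)
    {kap tau : ℝ} (hA1 : D.IsSlow kap tau) (hdur : 0 < D.tauStar) (hDel : 0 ≤ Del)
    (hdel : deltaStar D T t ≤ (Del : EReal)) {s : ℝ} (h0 : 0 ≤ s) (hsT : (s : EReal) < T) :
    ‖x s‖ ≤ kInv P.alpha1 (gam kap P.lam mu Del D.tauStar *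
      Real.exp (-bet c P.lam mu tau Del D.tauStar * s) * P.alpha2 ‖x₀‖) := by
  refine h.alpha1_kInf.le_kInv (norm_nonneg _) ((h.lower _).trans ?_)
  refine (hs.V_le h hc0 hc1 hmu hA2 hA1 hdur hDel hdel h0 hsT).trans ?_
  exact mul_le_mul_of_nonneg_left (h.upper x₀) (mul_pos (Real.exp_pos _) (Real.exp_pos _)).le

/-- If the bound decays, the Lyapunov function stays below its value on the sphere of radius
`rad`. -/
lemma IsSolution.V_le_alpha1_rad (hs : IsSolution P c D x₀ T t x) (h : P.IsISS)
    (hc0 : 0 < c) (hc1 : c < 1) (hmu : 0 < mu)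
    (hA2 : ∀ r, 0 ≤ r → P.gamma2 (4 * r) ≤ mu * P.alpha1 r)
    {kap tau : ℝ} (hA1 : D.IsSlow kap tau) (hdur : 0 < D.tauStar) (hDel : 0 ≤ Del)
    (hdel : deltaStar D T t ≤ (Del : EReal)) (hbet : 0 < bet c P.lam mu tau Del D.tauStar)
    {R : ℝ} (hR : ‖x₀‖ ≤ R) {s : ℝ} (h0 : 0 ≤ s) (hsT : (s : EReal) < T) :
    P.V (x s) ≤ P.alpha1 (P.rad (gam kap P.lam mu Del D.tauStar) R) := by
  have hg := gam_pos kap P.lam mu Del D.tauStar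
  have hR0 : 0 ≤ P.alpha2 R := h.alpha2_kInf.1.nonneg ((norm_nonneg _).trans hR)
  rw [Plant.rad, h.alpha1_kInf.apply_kInv (by positivity)]
  refine (hs.V_le h hc0 hc1 hmu hA2 hA1 hdur hDel hdel h0 hsT).trans ?_
  have h1 : Real.exp (-bet c P.lam mu tau Del D.tauStar * s) ≤ 1 :=
    Real.exp_le_one_iff.2 (by nlinarith)
  have h2 : P.V x₀ ≤ P.alpha2 R := (h.upper x₀).trans (h.alpha2_kInf.1.mono (norm_nonneg _) hR)
  exact mul_le_mul (mul_le_of_le_one_right hg.le h1) h2 (h.V_nonneg x₀) hg.le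

end Solution

/-! ## Continuation of solutions -/

/-- A bounded flow on a bounded half-open interval has a limit at the right end. -/
lemma exists_tendsto_of_heldFlow (hF : LocallyLipschitz fun p : Euc n × Euc n => P.F p.1 p.2)
    {w : Euc n} {a T₀ C : ℝ} (haT : a < T₀) {x : ℝ → Euc n}
    (hx : ∀ b < T₀, P.HeldFlow w a b x) (hC : ∀ s ∈ Ico a T₀, ‖x s‖ ≤ C) :
    ∃ y, Tendsto x (𝓝[<] T₀) (𝓝 y) := by
  obtain ⟨B, hB⟩ := (isCompact_closedBall (0 : Euc n) C).exists_bound_of_continuousOn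
    (locallyLipschitz_held hF w).continuous.continuousOn
  -- A bounded state has bounded speed, so the flow is Lipschitz on [a, T₀) and extends
  -- continuously.
  have hstep : ∀ r ∈ Ico a T₀, ∀ s ∈ Ico a T₀, r ≤ s → dist (x r) (x s) ≤ B * dist r s := by
    intro r hr s hs hrs
    have h1 := norm_image_sub_le_of_norm_deriv_right_le_segment (C := B)
      ((hx s hs.2).mono hr.1 le_rfl).1 ((hx s hs.2).mono hr.1 le_rfl).2
      (fun u hu => by
        rw [P.f_eq_F]
        exact hB _ (by simpa using hC u ⟨hr.1.trans hu.1, hu.2.trans hs.2⟩)) s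
      (right_mem_Icc.2 hrs)
    rw [dist_comm, dist_eq_norm, dist_comm r s, Real.dist_eq, abs_of_nonneg (sub_nonneg.2 hrs)]
    exact h1
  have hlip : LipschitzOnWith (Real.toNNReal B) x (Ico a T₀) := by
    refine LipschitzOnWith.of_dist_le_mul fun r hr s hs => ?_
    have hle : ∀ u v : ℝ, B * dist u v ≤ (Real.toNNReal B : ℝ) * dist u v := fun u v =>
      mul_le_mul_of_nonneg_right (Real.le_coe_toNNReal B) dist_nonneg
    rcases le_total r s with hrs | hrs
    · exact (hstep r hr s hs hrs).trans (hle r s)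
    · rw [dist_comm (x r), dist_comm r]
      exact (hstep s hs r hr hrs).trans (hle s r)
  obtain ⟨g, hg, heq⟩ := hlip.extend_finite_dimension
  refine ⟨g T₀, ((hg.continuous.tendsto T₀).mono_left nhdsWithin_le_nhds).congr' ?_⟩
  filter_upwards [Ico_mem_nhdsLT haT] with s hs using (heq hs).symm

lemma continuousWithinAt_glue {x z : ℝ → Euc n} {T₀ δ b s : ℝ} (hb : b ≤ T₀ + δ)
    (hx : ContinuousOn x {r : ℝ | 0 ≤ r ∧ r < T₀}) (hz : ContinuousOn z (Icc T₀ (T₀ + δ)))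
    (hlim : 0 < T₀ → Tendsto x (𝓝[<] T₀) (𝓝 (z T₀))) (h0 : 0 ≤ s) (hsb : s < b) :
    ContinuousWithinAt (fun r => if r < T₀ then x r else z r) {r : ℝ | 0 ≤ r ∧ r < b} s := by
  rcases lt_or_ge s T₀ with hs | hs
  · have h1 : {r : ℝ | 0 ≤ r ∧ r < T₀} ∈ 𝓝[{r : ℝ | 0 ≤ r ∧ r < b}] s := by
      filter_upwards [self_mem_nhdsWithin, mem_nhdsWithin_of_mem_nhds (Iio_mem_nhds hs)]
        with r hr hr' using ⟨hr.1, hr'⟩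
    refine ((hx s ⟨h0, hs⟩).mono_of_mem_nhdsWithin h1).congr_of_eventuallyEq ?_ (if_pos hs)
    filter_upwards [h1] with r hr using if_pos hr.2
  · have hsub : {r : ℝ | 0 ≤ r ∧ r < b} ⊆ {r : ℝ | 0 ≤ r ∧ r < T₀} ∪ Icc T₀ (T₀ + δ) := by
      intro r hr
      rcases lt_or_ge r T₀ with h | h
      · exact Or.inl ⟨hr.1, h⟩
      · exact Or.inr ⟨h, hr.2.le.trans hb⟩
    refine ContinuousWithinAt.mono (ContinuousWithinAt.union ?_ ?_) hsub
    · rcases hs.eq_or_lt with rfl | hs'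
      -- For T₀ = 0 nothing precedes the junction and there is no left limit to match.
      · rcases h0.eq_or_lt with rfl | h0'
        · have : {r : ℝ | 0 ≤ r ∧ r < 0} = ∅ := by
            ext r
            simp
          rw [this, ContinuousWithinAt, nhdsWithin_empty]
          exact tendsto_bot
        · have h2 : Tendsto (fun r => if r < T₀ then x r else z r) (𝓝[<] T₀) (𝓝 (z T₀)) := by
            refine (hlim h0').congr' ?_
            filter_upwards [self_mem_nhdsWithin] with r hr using (if_pos hr).symm
          rw [ContinuousWithinAt, if_neg (lt_irrefl T₀)]
          exact h2.mono_left (nhdsWithin_mono _ fun r hr => hr.2)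
      · refine continuousWithinAt_of_notMem_closure fun hmem => ?_
        have : closure {r : ℝ | 0 ≤ r ∧ r < T₀} ⊆ Iic T₀ :=
          closure_minimal (fun r hr => hr.2.le) isClosed_Iic
        exact not_lt.2 (this hmem) hs'
    · refine (hz s ⟨hs, hsb.le.trans hb⟩).congr (fun r hr => if_neg (not_lt.2 hr.1))
        (if_neg (not_lt.2 hs))

section Solution

variable {c del Del : ℝ} {D : DoS} {x₀ : Euc n} {t : ℕ → EReal} {x : ℝ → Euc n}

/-- A solution on `[0, T₀)` with limit `y` at `T₀` can be continued, if its sampling sequence can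
be continued beyond `T₀`. -/
lemma IsPaced.exists_extension {T₀ : ℝ}
    (hF : LocallyLipschitz fun p : Euc n × Euc n => P.F p.1 p.2)
    (hp : IsPaced P c D del Del x₀ (T₀ : EReal) t x) {y : Euc n} (hy0 : T₀ = 0 → y = x₀)
    (hy : 0 < T₀ → Tendsto x (𝓝[<] T₀) (𝓝 y)) {t' : ℕ → EReal} {K : ℕ} (ht' : Monotone t')
    (ht0 : t' 0 = 0) (hK : t' K ≤ (T₀ : EReal)) (hK' : (T₀ : EReal) < t' (K + 1))
    (hagree : ∀ k, t k < (T₀ : EReal) ∨ t' k < (T₀ : EReal) →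
      t' k = t k ∧ t' (k + 1) = t (k + 1))
    (hsucc : ∀ k, t' k = (T₀ : EReal) → T₀ ∉ D.denied → t' (k + 1) = P.nextSample c T₀ y)
    (hfail : ∀ k, t' k = (T₀ : EReal) → T₀ ∈ D.denied →
      (T₀ : EReal) + (del : EReal) ≤ t' (k + 1) ∧ t' (k + 1) ≤ (T₀ : EReal) + (Del : EReal))
    (hdel : 0 < del) :
    ∃ (T' : EReal) (x' : ℝ → Euc n), (T₀ : EReal) < T' ∧ IsPaced P c D del Del x₀ T' t' x' ∧
      ∀ s : ℝ, 0 ≤ s → (s : EReal) < (T₀ : EReal) → x' s = x s := by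
  obtain ⟨hs, hspaced, hdelta⟩ := hp
  have hT₀ : 0 ≤ T₀ := by exact_mod_cast hs.T_nonneg
  -- The sample at T₀ is computed with y in place of the continuation, which is not yet known; only
  -- the value at T₀ matters.
  obtain ⟨δ, hδ, z, hzT, hz⟩ :=
    exists_heldFlow hF (held D t' (fun s => if s < T₀ then x s else y) T₀) y T₀
  set w := held D t' (fun s => if s < T₀ then x s else y) T₀ with hw
  obtain ⟨q, hTq, hqK⟩ := EReal.lt_iff_exists_real_btwn.1 hK'
  rw [EReal.coe_lt_coe_iff] at hTq
  -- Stopping before t'(K + 1) ensures that no attempt falls in (T₀, b), so the sample stays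
  -- constant there.
  obtain ⟨b, hTb, hbδ, hbq⟩ : ∃ b, T₀ < b ∧ b ≤ T₀ + δ ∧ b ≤ q :=
    ⟨min (T₀ + δ) q, lt_min (by linarith) hTq, min_le_left _ _, min_le_right _ _⟩
  have hbK : (b : EReal) < t' (K + 1) := (EReal.coe_le_coe_iff.2 hbq).trans_lt hqK
  set x' : ℝ → Euc n := fun s => if s < T₀ then x s else z s with hx'
  have hx'l : ∀ s, s < T₀ → x' s = x s := fun s h => if_pos h
  have hx'r : ∀ s, T₀ ≤ s → x' s = z s := fun s h => if_neg (not_lt.2 h)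
  have hheld₁ : ∀ s, 0 ≤ s → s < T₀ → held D t' x' s = held D t x s := by
    intro s h0 hsT
    have hsT' : (s : EReal) < (T₀ : EReal) := EReal.coe_lt_coe_iff.2 hsT
    refine (held_congr ?_ (hs.bddAbove h0 hsT') ?_).symm
    · ext k
      refine exists_congr fun r => and_congr_right fun hr => ?_
      have hrT : (r : EReal) < (T₀ : EReal) := EReal.coe_lt_coe_iff.2 (hr.1.2.trans_lt hsT)
      constructor
      · intro h
        rw [(hagree k (Or.inl (h ▸ hrT))).1, h]
      · intro h
        rw [← (hagree k (Or.inr (h ▸ hrT))).1, h]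
    · intro k r hr hk
      have hrT := hr.1.2.trans_lt hsT
      rw [(hagree k (Or.inl (hk ▸ EReal.coe_lt_coe_iff.2 hrT))).1, hk, EReal.toReal_coe, hx'l r hrT]
  have hheld₂ : ∀ s, T₀ ≤ s → s < b → held D t' x' s = w := by
    intro s hTs hsb
    rw [held_eq_of_lt ht' hK hTs ((EReal.coe_lt_coe_iff.2 hsb).trans hbK), hw]
    refine held_congr rfl (bddAbove_of_lt ht' hK') fun k r hr hk => ?_
    rw [hk, EReal.toReal_coe]
    rcases hr.1.2.lt_or_eq with h | rfl
    · rw [hx'l r h, if_pos h]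
    · rw [hx'r r le_rfl, if_neg (lt_irrefl r), hzT]
  have hle : ∀ (k : ℕ) (s : ℝ), t' k = (s : EReal) → s < b → s ≤ T₀ := by
    intro k s hk hsb
    rcases le_or_gt k K with h | h
    · have := (ht' h).trans hK
      rw [hk] at this
      exact_mod_cast this
    · have := hbK.trans_le (ht' (Nat.succ_le_of_lt h))
      rw [hk, EReal.coe_lt_coe_iff] at this
      linarith
  have hold : ∀ (k : ℕ) (s : ℝ), t' k = (s : EReal) → s < T₀ →
      t k = (s : EReal) ∧ t' (k + 1) = t (k + 1) := fun k s hk hsT => by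
    have h1 := hagree k (Or.inr (hk ▸ EReal.coe_lt_coe_iff.2 hsT))
    exact ⟨h1.1 ▸ hk, h1.2⟩
  have hsol : IsSolution P c D x₀ (b : EReal) t' x' := by
    refine ⟨by exact_mod_cast hT₀.trans hTb.le, ?_, ht0, ht', ?_, ?_, ?_, ?_, ?_⟩
    · rcases hT₀.eq_or_lt with h | h
      · rw [hx'r 0 h.ge, ← hy0 h.symm, ← hzT, ← h]
      · rw [hx'l 0 h, hs.init]
    · intro s h0 hsb
      rw [EReal.coe_lt_coe_iff] at hsb
      rcases lt_or_ge s T₀ with h | h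
      · have hsT := EReal.coe_lt_coe_iff.2 h
        obtain ⟨k, hk, hk'⟩ := hs.cover s h0 hsT
        obtain ⟨h1, h2⟩ := hagree k (Or.inl (hk.trans_lt hsT))
        exact ⟨k, h1 ▸ hk, h2 ▸ hk'⟩
      · exact ⟨K, hK.trans (EReal.coe_le_coe_iff.2 h), (EReal.coe_lt_coe_iff.2 hsb).trans hbK⟩
    · have hset : ∀ u : ℝ, {s : ℝ | 0 ≤ s ∧ (s : EReal) < (u : EReal)} =
          {s : ℝ | 0 ≤ s ∧ s < u} := fun u => by
        ext s
        simp [EReal.coe_lt_coe_iff]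
      have hc := hs.cont
      rw [hset] at hc ⊢
      exact fun s hs' => continuousWithinAt_glue hbδ hc hz.1 (by rwa [hzT]) hs'.1 hs'.2
    · intro s h0 hsb
      rw [EReal.coe_lt_coe_iff] at hsb
      rcases lt_or_ge s T₀ with h | h
      · rw [hheld₁ s h0 h, hx'l s h]
        refine (hs.ode s h0 (EReal.coe_lt_coe_iff.2 h)).congr_of_eventuallyEq ?_ (hx'l s h)
        filter_upwards [mem_nhdsWithin_of_mem_nhds (Iio_mem_nhds h)] with r hr using hx'l r hr
      · rw [hheld₂ s h hsb, hx'r s h]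
        exact (hz.2 s ⟨h, hsb.trans_le hbδ⟩).congr (fun r hr => hx'r r (h.trans hr)) (hx'r s h)
    · intro k s hk hsb hsd
      rw [EReal.coe_lt_coe_iff] at hsb
      rcases (hle k s hk hsb).lt_or_eq with h | rfl
      · obtain ⟨h1, h2⟩ := hold k s hk h
        rw [h2, hx'l s h]
        exact hs.trigger k s h1 (EReal.coe_lt_coe_iff.2 h) hsd
      · rw [hx'r s le_rfl, hzT]
        exact hsucc k hk hsd
    · intro k s hk hsb hsd
      rw [EReal.coe_lt_coe_iff] at hsb
      rcases (hle k s hk hsb).lt_or_eq with h | rfl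
      · obtain ⟨h1, h2⟩ := hold k s hk h
        rw [h2, hk, ← h1]
        exact hs.retry k s h1 (EReal.coe_lt_coe_iff.2 h) hsd
      · rw [hk]
        refine lt_of_lt_of_le ?_ (hfail k hk hsd).1
        rw [← EReal.coe_add, EReal.coe_lt_coe_iff]
        linarith
  refine ⟨b, x', EReal.coe_lt_coe_iff.2 hTb, ⟨hsol, ?_, ?_⟩, fun s _ hsT =>
    hx'l s (EReal.coe_lt_coe_iff.1 hsT)⟩
  · intro k s hk hsb hsd
    rw [EReal.coe_lt_coe_iff] at hsb
    rcases (hle k s hk hsb).lt_or_eq with h | rfl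
    · obtain ⟨h1, h2⟩ := hold k s hk h
      rw [h2, hk, ← h1]
      exact hspaced k s h1 (EReal.coe_lt_coe_iff.2 h) hsd
    · rw [hk]
      exact (hfail k hk hsd).1
  · rw [deltaStar_le_iff] at hdelta ⊢
    intro k s hk hsb hsd
    rw [EReal.coe_lt_coe_iff] at hsb
    rcases (hle k s hk hsb).lt_or_eq with h | rfl
    · obtain ⟨h1, h2⟩ := hold k s hk h
      rw [h2]
      exact hdelta k s h1 (EReal.coe_lt_coe_iff.2 h) hsd
    · exact (hfail k hk hsd).2

/-- With a positive minimal inter-sampling time, a bounded interval holds finitely many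
attempts. -/
lemma IsSolution.exists_le_attempt {T₀ eps : ℝ} (hs : IsSolution P c D x₀ (T₀ : EReal) t x)
    (heps : 0 < eps)
    (hrate : ∀ k, t k < (T₀ : EReal) → t k + (eps : EReal) ≤ t (k + 1)) :
    ∃ K, (T₀ : EReal) ≤ t K := by
  by_contra! hcon
  have hgrow : ∀ k : ℕ, ((k * eps : ℝ) : EReal) ≤ t k := by
    intro k
    induction k with
    | zero => simp [hs.t_zero]
    | succ k ih =>
      refine le_trans ?_ (hrate k (hcon k))
      have : (((k + 1 : ℕ) * eps : ℝ) : EReal) = ((k * eps : ℝ) : EReal) + (eps : EReal) := by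
        rw [← EReal.coe_add, Nat.cast_succ, add_one_mul]
      rw [this]
      gcongr
  obtain ⟨k, hk⟩ := exists_nat_gt (T₀ / eps)
  have h1 := (hgrow k).trans_lt (hcon k)
  rw [EReal.coe_lt_coe_iff] at h1
  rw [div_lt_iff₀ heps] at hk
  linarith

lemma IsMaximal.eq_top {T : EReal} (h : P.IsISS)
    (hF : LocallyLipschitz fun p : Euc n × Euc n => P.F p.1 p.2)
    (hc0 : 0 < c) (hc1 : c < 1) (hpsi : LocallyLipschitz (P.psi c))
    (hdel : 0 < del) (hdelDel : del ≤ Del) (hmax : IsMaximal P c D del Del x₀ T t x)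
    {eps C : ℝ} (heps : 0 < eps) (hrate : ∀ k, t k < T → t k + (eps : EReal) ≤ t (k + 1))
    (hC : ∀ s : ℝ, 0 ≤ s → (s : EReal) < T → ‖x s‖ ≤ C) : T = ⊤ := by
  classical
  by_contra hT
  obtain ⟨hp, hno⟩ := hmax
  have hs := hp.1
  lift T to ℝ using ⟨hT, (lt_of_lt_of_le EReal.bot_lt_zero hs.T_nonneg).ne'⟩ with T₀
  have hT₀ : 0 ≤ T₀ := by exact_mod_cast hs.T_nonneg
  have hex := hs.exists_le_attempt heps hrate
  -- With K minimal, the sample is constant on a left neighbourhood of T₀ whenever T₀ > 0, so the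
  -- limit of x at T₀ exists.
  obtain ⟨K, hK, hmin⟩ : ∃ K, (T₀ : EReal) ≤ t K ∧ ∀ j < K, t j < (T₀ : EReal) :=
    ⟨Nat.find hex, Nat.find_spec hex, fun j hj => not_le.1 (Nat.find_min hex hj)⟩
  have hlt : ∀ k, t k < (T₀ : EReal) → k < K := fun k hk => by
    by_contra hcon
    exact absurd (hK.trans (hs.t_mono (not_lt.1 hcon))) (not_le.2 hk)
  obtain ⟨y, hy0, hy⟩ : ∃ y, (T₀ = 0 → y = x₀) ∧ (0 < T₀ → Tendsto x (𝓝[<] T₀) (𝓝 y)) := by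
    rcases hT₀.eq_or_lt with h0 | h0
    · exact ⟨x₀, fun _ => rfl, fun h' => absurd h0 h'.ne⟩
    · have hK0 : K ≠ 0 := by
        rintro rfl
        rw [hs.t_zero] at hK
        exact absurd (by exact_mod_cast hK) (not_le.2 h0)
      obtain ⟨j, rfl⟩ := Nat.exists_eq_succ_of_ne_zero hK0
      obtain ⟨a, ha, ha0, haT⟩ := hs.exists_real (hmin j j.lt_succ_self)
      obtain ⟨y, hy⟩ := exists_tendsto_of_heldFlow hF (EReal.coe_lt_coe_iff.1 haT)
        (fun b hb => hs.heldFlow ha (EReal.coe_lt_coe_iff.2 hb)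
          ((EReal.coe_lt_coe_iff.2 hb).le.trans hK))
        (fun s hs' => hC s (ha0.trans hs'.1) (EReal.coe_lt_coe_iff.2 hs'.2))
      exact ⟨y, fun h' => absurd h' h0.ne', fun _ => hy⟩
  rcases hK.lt_or_eq with hKT | hKT
  · obtain ⟨j, rfl⟩ : ∃ j, K = j + 1 := Nat.exists_eq_succ_of_ne_zero (by
      rintro rfl
      rw [hs.t_zero] at hKT
      exact absurd (by exact_mod_cast hKT) (not_lt.2 hT₀))
    have hne : ∀ k, t k ≠ (T₀ : EReal) := fun k hk => by
      rcases lt_or_ge k (j + 1) with h1 | h1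
      · exact (hmin k h1).ne hk
      · exact (hKT.trans_le (hs.t_mono h1)).ne' hk
    obtain ⟨T', x', hTT', hp', hxx'⟩ := hp.exists_extension hF hy0 hy hs.t_mono hs.t_zero
      (hmin j j.lt_succ_self).le hKT (fun k _ => ⟨rfl, rfl⟩) (fun k hk => absurd hk (hne k))
      (fun k hk => absurd hk (hne k)) hdel
    exact hno ⟨T', t, x', hTT', hp', hxx', fun _ _ => rfl⟩
  -- An attempt falls exactly at T₀. Since the rules bind only at attempts before T₀, the old t(K +
  -- 1) is arbitrary and is replaced by an admissible N.
  · obtain ⟨N, hTN, hN₁, hN₂⟩ : ∃ N : EReal, (T₀ : EReal) < N ∧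
        (T₀ ∉ D.denied → N = P.nextSample c T₀ y) ∧
        (T₀ ∈ D.denied → N = (T₀ : EReal) + (del : EReal)) := by
      by_cases hd : T₀ ∈ D.denied
      · refine ⟨_, ?_, fun h' => absurd hd h', fun _ => rfl⟩
        rw [← EReal.coe_add, EReal.coe_lt_coe_iff]
        linarith
      · exact ⟨_, h.lt_nextSample hF hc0 hc1 hpsi T₀ y, fun _ => rfl, fun h' => absurd h' hd⟩
    set t' : ℕ → EReal := fun j => if j ≤ K then t j else N with ht'
    have htl : ∀ j, j ≤ K → t' j = t j := fun j hj => if_pos hj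
    have htr : ∀ j, K < j → t' j = N := fun j hj => if_neg (not_le.2 hj)
    have hmono : Monotone t' := by
      intro i j hij
      rcases le_or_gt j K with hj | hj
      · rw [htl j hj, htl i (hij.trans hj)]
        exact hs.t_mono hij
      · rw [htr j hj]
        rcases le_or_gt i K with hi | hi
        · rw [htl i hi]
          exact (hs.t_mono hi).trans (hKT ▸ hTN.le)
        · rw [htr i hi]
    have hlt' : ∀ k, t' k < (T₀ : EReal) → k < K := fun k hk => by
      by_contra hcon
      refine absurd (hmono (not_lt.1 hcon)) (not_le.2 ?_)
      rwa [htl K le_rfl, ← hKT]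
    have heqK : ∀ k, t' k = (T₀ : EReal) → t' (k + 1) = N := fun k hk => by
      refine htr _ (Nat.lt_succ_of_le ?_)
      by_contra hcon
      have hkK := not_le.1 hcon
      rw [htl k hkK.le] at hk
      exact (hmin k hkK).ne hk
    have hagree : ∀ k, t k < (T₀ : EReal) ∨ t' k < (T₀ : EReal) →
        t' k = t k ∧ t' (k + 1) = t (k + 1) := fun k hk => by
      have hkK : k < K := hk.elim (hlt k) (hlt' k)
      exact ⟨htl k hkK.le, htl (k + 1) hkK⟩
    obtain ⟨T', x', hTT', hp', hxx'⟩ := hp.exists_extension (t' := t') (K := K) hF hy0 hy hmono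
      (by rw [htl 0 (Nat.zero_le K), hs.t_zero]) (by rw [htl K le_rfl, ← hKT])
      (by rwa [htr (K + 1) K.lt_succ_self]) hagree
      (fun k hk hd => by rw [heqK k hk, hN₁ hd])
      (fun k hk hd => by
        rw [heqK k hk, hN₂ hd]
        exact ⟨le_rfl, by gcongr⟩) hdel
    exact hno ⟨T', t', x', hTT', hp', hxx', fun k hk => (hagree k (Or.inl hk)).1⟩

end Solution

/-! ### Positivity of the rate and inter-sampling times along solutions -/

lemma bet_pos {c lam mu tau Del tauS : ℝ} (hc0 : 0 < c) (hlam : 0 < lam) (htau : 0 < tau)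
    (h : (lam + 2 * mu) / (c * lam) * (1 + Del / tauS) < tau) :
    0 < bet c lam mu tau Del tauS := by
  have hcl : 0 < c * lam := mul_pos hc0 hlam
  rw [div_mul_eq_mul_div, div_lt_iff₀ hcl] at h
  rw [bet, div_mul_eq_mul_div, sub_pos, div_lt_iff₀ htau]
  linarith

/-- After a success the next attempt is made at the earliest after `epsR` units of time. -/
lemma IsSolution.add_epsR_le {c mu Del : ℝ} {D : DoS} {x₀ : Euc n} {T : EReal} {t : ℕ → EReal}
    {x : ℝ → Euc n} (hs : IsSolution P c D x₀ T t x) (h : P.IsISS)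
    (hF : LocallyLipschitz fun p : Euc n × Euc n => P.F p.1 p.2)
    (hc0 : 0 < c) (hc1 : c < 1) (hmu : 0 < mu)
    (hA2 : ∀ r, 0 ≤ r → P.gamma2 (4 * r) ≤ mu * P.alpha1 r)
    {kap tau : ℝ} (hA1 : D.IsSlow kap tau) (hdur : 0 < D.tauStar) (hDel : 0 ≤ Del)
    (hdel : deltaStar D T t ≤ (Del : EReal)) (hbet : 0 < bet c P.lam mu tau Del D.tauStar)
    {R L sig : ℝ} (hR : ‖x₀‖ ≤ R) (hL : 0 < L) (hsig : 0 < sig)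
    (hFB : P.FieldBound (P.rad (gam kap P.lam mu Del D.tauStar) R) L)
    (hE : P.ErrBound c (P.rad (gam kap P.lam mu Del D.tauStar) R) sig)
    {k : ℕ} {s : ℝ} (hk : t k = (s : EReal)) (hsT : (s : EReal) < T) (hsd : s ∉ D.denied) :
    t k + (epsR L sig : EReal) ≤ t (k + 1) := by
  have hR0 : 0 ≤ P.alpha2 R := h.alpha2_kInf.1.nonneg ((norm_nonneg _).trans hR)
  rw [hs.trigger k s hk hsT hsd, hk]
  exact h.add_epsR_le_nextSample hF hc0 hc1
    (h.alpha1_kInf.kInv_nonneg (mul_nonneg (gam_pos _ _ _ _ _).le hR0)) hL hsig hFB hE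
    (hs.V_le_alpha1_rad h hc0 hc1 hmu hA2 hA1 hdur hDel hdel hbet hR (hs.nonneg_of_eq hk) hsT) s

lemma Plant.IsISS.semiGlobalFSR (h : P.IsISS)
    (hF : LocallyLipschitz fun p : Euc n × Euc n => P.F p.1 p.2) {c mu del Del : ℝ} {D : DoS}
    (hc0 : 0 < c) (hc1 : c < 1) (hpsi : LocallyLipschitz (P.psi c)) (hmu : 0 < mu)
    (hA2 : ∀ r, 0 ≤ r → P.gamma2 (4 * r) ≤ mu * P.alpha1 r)
    {kap tau : ℝ} (hA1 : D.IsSlow kap tau) (hdur : 0 < D.tauStar) (hDel : 0 ≤ Del)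
    (hbet : 0 < bet c P.lam mu tau Del D.tauStar) (hdel : 0 < del) :
    SemiGlobalFSR P c D del Del := by
  intro R hR
  set ρ := P.rad (gam kap P.lam mu Del D.tauStar) R
  have hρ : 0 ≤ ρ := h.alpha1_kInf.kInv_nonneg
    (mul_nonneg (gam_pos _ _ _ _ _).le (h.alpha2_kInf.1.nonneg hR.le))
  obtain ⟨L, hL, hLip⟩ := P.exists_fieldLip hF ρ
  obtain ⟨sig, hsig, hErr⟩ := P.exists_errLip hpsi ρ
  refine ⟨min del (epsR L sig), lt_min hdel (epsR_pos hL hsig), ?_⟩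
  rintro x₀ T t x ⟨hs, hspaced, hdelta⟩ hx₀ k hk
  obtain ⟨s, hks, -, hsT⟩ := hs.exists_real hk
  by_cases hsd : s ∈ D.denied
  · refine le_trans ?_ (hspaced k s hks hsT hsd)
    gcongr
    exact_mod_cast min_le_left _ _
  · refine le_trans ?_ (hs.add_epsR_le h hF hc0 hc1 hmu hA2 hA1 hdur hDel hdelta hbet hx₀ hL hsig
      (hLip.fieldBound hρ (h.F_zero hF)) (hErr.errBound h hρ) hks hsT hsd)
    gcongr
    exact_mod_cast min_le_right _ _

end EventDoS

open EventDoS in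
theorem theorem3 {n m : ℕ} (P : Plant n m) (hISS : P.IsISS)
    (hF : LocallyLipschitz fun p : Euc n × Euc n => P.F p.1 p.2)
    (c : ℝ) (hc0 : 0 < c) (hc1 : c < 1)
    (hpsi : LocallyLipschitz (P.psi c))
    (mu : ℝ) (hmu : 0 < mu) (hA2 : ∀ r, 0 ≤ r → P.gamma2 (4 * r) ≤ mu * P.alpha1 r)
    (D : DoS) (kap tau : ℝ) (hA1 : D.IsSlow kap tau) (hdur : 0 < D.tauStar)
    (Del : ℝ) (hDel : 0 ≤ Del) :
    -- The exponential bound, on the whole interval of existence of any solution.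
    (∀ R > 0, ∀ (x₀ : Euc n) (T : EReal) (t : ℕ → EReal) (x : ℝ → Euc n),
      IsSolution P c D x₀ T t x → deltaStar D T t ≤ (Del : EReal) → ‖x₀‖ ≤ R →
      ∀ s : ℝ, 0 ≤ s → (s : EReal) < T →
        ‖x s‖ ≤ kInv P.alpha1 (gam kap P.lam mu Del D.tauStar *
          Real.exp (-bet c P.lam mu tau Del D.tauStar * s) * P.alpha2 ‖x₀‖)) ∧
    -- If attacks are rare enough:
    ((P.lam + 2 * mu) / (c * P.lam) * (1 + Del / D.tauStar) < tau →
      -- the rate is positive, the bound is of class `KL`, the origin is stable,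
      0 < bet c P.lam mu tau Del D.tauStar ∧
      IsClassKL (fun r s => kInv P.alpha1 (gam kap P.lam mu Del D.tauStar *
          Real.exp (-bet c P.lam mu tau Del D.tauStar * s) * P.alpha2 r)) ∧
      SemiGlobalAS P c D Del ∧
      -- the solutions exist for all times and are sampled at a finite rate,
      (∀ del, 0 < del → del ≤ Del →
        ∀ (x₀ : Euc n) (T : EReal) (t : ℕ → EReal) (x : ℝ → Euc n),
          IsMaximal P c D del Del x₀ T t x → T = ⊤) ∧
      (∀ del, 0 < del → SemiGlobalFSR P c D del Del) ∧
      -- and the inter-sampling times are bounded below by `epsR`.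
      ∀ R > 0,
        (∃ L > 0, P.FieldLip (P.rad (gam kap P.lam mu Del D.tauStar) R) L) ∧
        (∃ sig > 0, P.ErrLip c (P.rad (gam kap P.lam mu Del D.tauStar) R) sig) ∧
        (∀ L, P.FieldLip (P.rad (gam kap P.lam mu Del D.tauStar) R) L →
          P.FieldBound (P.rad (gam kap P.lam mu Del D.tauStar) R) L) ∧
        (∀ sig > 0, P.ErrLip c (P.rad (gam kap P.lam mu Del D.tauStar) R) sig →
          P.ErrBound c (P.rad (gam kap P.lam mu Del D.tauStar) R) sig) ∧
        ∀ L > 0, ∀ sig > 0,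
          P.FieldBound (P.rad (gam kap P.lam mu Del D.tauStar) R) L →
          P.ErrBound c (P.rad (gam kap P.lam mu Del D.tauStar) R) sig →
          0 < epsR L sig ∧
          ∀ (x₀ : Euc n) (T : EReal) (t : ℕ → EReal) (x : ℝ → Euc n),
            IsSolution P c D x₀ T t x → deltaStar D T t ≤ (Del : EReal) → ‖x₀‖ ≤ R →
            -- after every successful transmission,
            (∀ (k : ℕ) (s : ℝ), t k = (s : EReal) → (s : EReal) < T → s ∉ D.denied →
              t k + (epsR L sig : EReal) ≤ t (k + 1)) ∧
            -- and after every attempt if denied attempts are not repeated faster.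
            (RetrySpaced D T t (epsR L sig) →
              ∀ k, t k < T → t k + (epsR L sig : EReal) ≤ t (k + 1))) := by
  have hnorm : ∀ (x₀ : Euc n) (T : EReal) (t : ℕ → EReal) (x : ℝ → Euc n),
      IsSolution P c D x₀ T t x → deltaStar D T t ≤ (Del : EReal) →
      ∀ s : ℝ, 0 ≤ s → (s : EReal) < T →
        ‖x s‖ ≤ kInv P.alpha1 (gam kap P.lam mu Del D.tauStar *
          Real.exp (-bet c P.lam mu tau Del D.tauStar * s) * P.alpha2 ‖x₀‖) :=
    fun _ _ _ _ hs hdel _ h0 hsT => hs.norm_le hISS hc0 hc1 hmu hA2 hA1 hdur hDel hdel h0 hsT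
  refine ⟨fun R _ x₀ T t x hs hdel _ => hnorm x₀ T t x hs hdel, fun htau => ?_⟩
  have hbet := bet_pos hc0 hISS.lam_pos hA1.2.2.1 htau
  have hKL := hISS.alpha1_kInf.isClassKL_exp hISS.alpha2_kInf
    (gam_pos kap P.lam mu Del D.tauStar) hbet
  have hFSR : ∀ del, 0 < del → SemiGlobalFSR P c D del Del := fun del hdel =>
    hISS.semiGlobalFSR hF hc0 hc1 hpsi hmu hA2 hA1 hdur hDel hbet hdel
  refine ⟨hbet, hKL, ⟨_, hKL, fun R _ x₀ T t x hs hdel _ => hnorm x₀ T t x hs hdel⟩, ?_, hFSR, ?_⟩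
  · intro del hdel hdelDel x₀ T t x hmax
    -- The radius in `SemiGlobalFSR` must be positive, and x₀ may be 0.
    have hx₀ : ‖x₀‖ ≤ ‖x₀‖ + 1 := by linarith
    obtain ⟨eps, heps, hrate⟩ := hFSR del hdel (‖x₀‖ + 1) (by positivity)
    refine hmax.eq_top hISS hF hc0 hc1 hpsi hdel hdelDel heps (hrate x₀ T t x hmax.1 hx₀)
      fun s h0 hsT => hISS.alpha1_kInf.1.le_of_apply_le (norm_nonneg _) ?_ ((hISS.lower _).trans
        (hmax.1.1.V_le_alpha1_rad hISS hc0 hc1 hmu hA2 hA1 hdur hDel hmax.1.2.2 hbet hx₀ h0 hsT))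
    exact hISS.alpha1_kInf.kInv_nonneg (mul_nonneg (gam_pos _ _ _ _ _).le
      (hISS.alpha2_kInf.1.nonneg (by positivity)))
  · intro R hR
    have hρ : 0 ≤ P.rad (gam kap P.lam mu Del D.tauStar) R := hISS.alpha1_kInf.kInv_nonneg
      (mul_nonneg (gam_pos _ _ _ _ _).le (hISS.alpha2_kInf.1.nonneg hR.le))
    refine ⟨P.exists_fieldLip hF _, P.exists_errLip hpsi _,
      fun L hL => hL.fieldBound hρ (hISS.F_zero hF), fun sig _ hsig => hsig.errBound hISS hρ,
      fun L hL sig hsig hFB hE => ⟨epsR_pos hL hsig, fun x₀ T t x hs hdel hx₀ => ?_⟩⟩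
    have hsuccess : ∀ (k : ℕ) (s : ℝ), t k = (s : EReal) → (s : EReal) < T → s ∉ D.denied →
        t k + (epsR L sig : EReal) ≤ t (k + 1) := fun k s hk hsT hsd =>
      hs.add_epsR_le hISS hF hc0 hc1 hmu hA2 hA1 hdur hDel hdel hbet hx₀ hL hsig hFB hE hk hsT hsd
    refine ⟨hsuccess, fun hspaced k hk => ?_⟩
    obtain ⟨s, hks, -, hsT⟩ := hs.exists_real hk
    by_cases hsd : s ∈ D.denied
    · exact hspaced k s hks hsT hsd
    · exact hsuccess k s hks hsT hsd
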